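/- Let $\mathcal{E}$ be an additive category. A morphism $f$ in an additive category with kernels and cokernels is *strict* if the canonical morphism $\operatorname{coker}\ker f\to\ker\operatorname{coker} f$ is an isomorphism. $\mathcal{E}$ is *quasi-abelian* if it has kernels and cokernels, every pullback of a strict epimorphism is a strict epimorphism, and every pushout of a strict monomorphism is a strict monomorphism. A *torsion pair* $(\mathcal{T},\mathcal{F})$ in an abelian category $\mathcal{C}$ consists of two strictly full subcategories with $\operatorname{Hom}(\mathcal{T},\mathcal{F})=0$ such that every object $C$ of $\mathcal C$ fits in an exact sequence $0\to T\to C\to F\to 0$ with $T\in\mathcal{T}$, $F\in\mathcal{F}$. It is *tilting* if every object of $\mathcal{C}$ is a subobject of an object of $\mathcal{T}$, and *cotilting* if every object of $\mathcal{C}$ is a quotient of an object of $\mathcal{F}$. For a quasi-abelian category $\mathcal{E}$, a complex $L$ is *strictly exact in degree $n$* if $d^{n-1}$ is strict and $\operatorname{im} d^{n-1}\to\ker d^n$ is an isomorphism, where $\operatorname{im}=\ker\operatorname{coker}$; $D(\mathcal{E})$ is the Verdier quotient of the homotopy category $K(\mathcal{E})$ of unbounded complexes by the complexes that are strictly exact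 in all degrees. The *left heart* $\mathcal{LH}(\mathcal{E})\subset D(\mathcal{E})$ is the heart $D^{\le 0}\cap D^{\ge 0}$ of the left t-structure, where $D^{\le 0}$ (resp. $D^{\ge 0}$) consists of the objects isomorphic to complexes strictly exact in all degrees $n>0$ (resp. $n<0$). The *right heart* is its dual, $\mathcal{RH}(\mathcal{E})=\mathcal{LH}(\mathcal{E}^{\mathrm{op}})^{\mathrm{op}}$. $\mathcal{E}$ maps to both hearts by sending an object to the complex concentrated in degree $0$. Then the following are equivalent: 1. $\mathcal{E}$ is quasi-abelian. 2. There is a cotilting torsion pair $(\mathcal{T},\mathcal{F})$ in an abelian category $\mathcal{C}$ with $\mathcal{E}\cong\mathcal{F}$. 3. There is a tilting torsion pair $(\mathcal{T}',\mathcal{F}')$ in an abelian category $\mathcal{C}'$ with $\mathcal{E}\cong\mathcal{T}'$. Moreover, for every $(\mathcal{C},\mathcal{T},\mathcal{F})$ and equivalence $\mathcal{E}\cong\mathcal{F}$ as in (2), there is an equivalence $\mathcal{LH}(\mathcal{E})\cong\mathcal{C}$, and for every $(\mathcal{C}',\mathcal{T}',\mathcal{F}')$ and equivalence $\mathcal{E}\cong\mathcal{T}'$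 as in (3), there is an equivalence $\mathcal{RH}(\mathcal{E})\cong\mathcal{C}'$; these equivalences are compatible, up to isomorphism, with the functors from $\mathcal{E}$. -/

import Mathlib

open CategoryTheory CategoryTheory.Limits

universe w' w v u

noncomputable section

namespace QuasiAbelian

/-! ### Strict morphisms and quasi-abelian categories

Throughout, an additive category is a preadditive category with a zero object and binary
biproducts. -/

section Strict

variable {E : Type u} [Category.{v} E] [Preadditive E] [HasKernels E] [HasCokernels E]

/-- A morphism `f` is strict if the canonical morphism `coker (ker f) ⟶ ker (coker f)` is an
isomorphism. -/
def IsStrict {X Y : E} (f : X ⟶ Y) : Prop :=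
  IsIso (Abelian.coimageImageComparison f)

/-- A strict epimorphism: an epimorphism which is strict. -/
def IsStrictEpi {X Y : E} (f : X ⟶ Y) : Prop := Epi f ∧ IsStrict f

/-- A strict monomorphism: a monomorphism which is strict. -/
def IsStrictMono {X Y : E} (f : X ⟶ Y) : Prop := Mono f ∧ IsStrict f

end Strict

/-- An additive category is quasi-abelian if it has kernels and cokernels, if every pullback of a
strict epimorphism is a strict epimorphism and every pushout of a strict monomorphism is a strict
monomorphism. -/
class IsQuasiAbelian (E : Type u) [Category.{v} E] [Preadditive E] [HasZeroObject E]
    [HasBinaryBiproducts E] : Prop where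
  [hasKernels : HasKernels E]
  [hasCokernels : HasCokernels E]
  isStrictEpi_of_isPullback : ∀ {P X Y Z : E} {fst : P ⟶ X} {snd : P ⟶ Y} {f : X ⟶ Z} {g : Y ⟶ Z},
    IsPullback fst snd f g → IsStrictEpi g → IsStrictEpi fst
  isStrictMono_of_isPushout : ∀ {Z X Y P : E} {f : Z ⟶ X} {g : Z ⟶ Y} {inl : X ⟶ P} {inr : Y ⟶ P},
    IsPushout f g inl inr → IsStrictMono f → IsStrictMono inr

attribute [instance] IsQuasiAbelian.hasKernels IsQuasiAbelian.hasCokernels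

/-! ### Strictly exact complexes -/

section StrictlyExact

variable {E : Type u} [Category.{v} E] [Preadditive E] [HasKernels E] [HasCokernels E]

theorem image_ι_comp_g_eq_zero (S : ShortComplex E) : Abelian.image.ι S.f ≫ S.g = 0 := by
  rw [← cokernel.π_desc S.f S.g S.zero, kernel.condition_assoc, zero_comp]

/-- A sequence `X₁ ⟶ X₂ ⟶ X₃` with zero composition is strictly exact if its first morphism is
strict and the canonical morphism from the image of the first morphism to the kernel of
the second one is an isomorphism. -/
def StrictlyExact (S : ShortComplex E) : Prop :=
  IsStrict S.f ∧ IsIso (kernel.lift S.g (Abelian.image.ι S.f) (image_ι_comp_g_eq_zero S))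

/-- Strict exactness of a complex `K` at the degree `n`, i.e. strict exactness of the sequence
`Kⁿ⁻¹ ⟶ Kⁿ ⟶ Kⁿ⁺¹`. -/
def StrictlyExactAt (K : CochainComplex E ℤ) (n : ℤ) : Prop := StrictlyExact (K.sc n)

theorem strictlyExact_of_isZero {S : ShortComplex E} (h : IsZero S.X₂) : StrictlyExact S := by
  have hf : S.f = 0 := h.eq_of_tgt _ _
  have h1 : IsZero (Abelian.image S.f) := IsZero.of_mono (Abelian.image.ι S.f) h
  have h2 : IsZero (kernel S.g) := IsZero.of_mono (kernel.ι S.g) h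
  have h3 : IsZero (Abelian.coimage S.f) := by
    have : Abelian.coimage.π S.f = 0 := by
      have hk : kernel.lift S.f (𝟙 S.X₁) (by simp [hf]) ≫ kernel.ι S.f = 𝟙 _ := by simp
      have hc : kernel.ι S.f ≫ Abelian.coimage.π S.f = 0 := cokernel.condition _
      rw [← Category.id_comp (Abelian.coimage.π S.f), ← hk, Category.assoc, hc, comp_zero]
    exact IsZero.of_epi_eq_zero _ this
  exact ⟨h3.isIso h1 _, h1.isIso h2 _⟩

theorem strictlyExactAt_single [HasZeroObject E] (X : E) (n : ℤ) (hn : n ≠ 0) :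
    StrictlyExactAt ((HomologicalComplex.single E (ComplexShape.up ℤ) 0).obj X) n :=
  strictlyExact_of_isZero (HomologicalComplex.isZero_single_obj_X (ComplexShape.up ℤ) 0 X n hn)

end StrictlyExact

/-! ### The derived category of a quasi-abelian category and its left heart -/

section LeftHeart

variable (E : Type u) [Category.{v} E] [Preadditive E] [HasZeroObject E] [HasBinaryBiproducts E]
  [HasKernels E] [HasCokernels E]

/-- The homotopy category `K(E)` of unbounded cochain complexes. -/
abbrev HoCat : Type (max u v) := HomotopyCategory E (ComplexShape.up ℤ)

/-- The objects of `K(E)` that are isomorphic to a complex which is strictly exact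
in every degree. -/
def acyclic : ObjectProperty (HoCat E) := fun X =>
  ∃ L : CochainComplex E ℤ, (∀ n : ℤ, StrictlyExactAt L n) ∧
    Nonempty ((HomotopyCategory.quotient E (ComplexShape.up ℤ)).obj L ≅ X)

/-- The derived category `D(E)`: the Verdier quotient of `K(E)` by the strictly exact complexes,
i.e. the localization of `K(E)` at the morphisms whose cone is strictly exact. -/
abbrev DerCat : Type (max u v) := (acyclic E).trW.Localization

/-- The canonical functor from complexes to the derived category. -/
abbrev toDerCat : CochainComplex E ℤ ⥤ DerCat E :=
  HomotopyCategory.quotient E (ComplexShape.up ℤ) ⋙ (acyclic E).trW.Q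

/-- `D^{≤ 0}` of the left t-structure: the complexes that are strictly exact in every
degree `n > 0`. -/
def leftLE : ObjectProperty (DerCat E) := fun X =>
  ∃ L : CochainComplex E ℤ, (∀ n : ℤ, 0 < n → StrictlyExactAt L n) ∧ Nonempty ((toDerCat E).obj L ≅ X)

/-- `D^{≥ 0}` of the left t-structure: the complexes that are strictly exact in every
degree `n < 0`. -/
def leftGE : ObjectProperty (DerCat E) := fun X =>
  ∃ L : CochainComplex E ℤ, (∀ n : ℤ, n < 0 → StrictlyExactAt L n) ∧ Nonempty ((toDerCat E).obj L ≅ X)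

/-- The left heart `LH(E)`: the heart `D^{≤ 0} ∩ D^{≥ 0}` of the left t-structure on `D(E)`. -/
abbrev LeftHeart : Type (max u v) := (leftLE E ⊓ leftGE E).FullSubcategory

/-- The canonical functor `E ⥤ LH(E)`, sending an object to the corresponding complex
concentrated in degree `0`. -/
def toLeftHeart : E ⥤ LeftHeart E :=
  (leftLE E ⊓ leftGE E).lift (HomologicalComplex.single E (ComplexShape.up ℤ) 0 ⋙ toDerCat E)
    (fun X => ⟨⟨_, fun n hn => strictlyExactAt_single X n hn.ne', ⟨Iso.refl _⟩⟩,
      ⟨_, fun n hn => strictlyExactAt_single X n hn.ne, ⟨Iso.refl _⟩⟩⟩)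

end LeftHeart

/-! ### The right heart, by duality -/

section RightHeart

variable (E : Type u) [Category.{v} E] [Preadditive E]

instance hasBinaryBiproducts_opposite [HasBinaryBiproducts E] : HasBinaryBiproducts Eᵒᵖ :=
  HasBinaryBiproducts.of_hasBinaryProducts

instance hasKernels_opposite [HasCokernels E] : HasKernels Eᵒᵖ where
  has_limit f := ⟨⟨_, CokernelCofork.IsColimit.ofπOp _ (cokernel.condition f.unop)
    (cokernelIsCokernel f.unop)⟩⟩

instance hasCokernels_opposite [HasKernels E] : HasCokernels Eᵒᵖ where
  has_colimit f := ⟨⟨_, KernelFork.IsLimit.ofιOp _ (kernel.condition f.unop)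
    (kernelIsKernel f.unop)⟩⟩

variable [HasZeroObject E] [HasBinaryBiproducts E] [HasKernels E] [HasCokernels E]

/-- The right heart `RH(E)`, the dual of the left heart: `RH(E) = LH(Eᵒᵖ)ᵒᵖ`. -/
abbrev RightHeart : Type (max u v) := (LeftHeart Eᵒᵖ)ᵒᵖ

/-- The canonical functor `E ⥤ RH(E)`, sending an object to the corresponding complex
concentrated in degree `0`. -/
def toRightHeart : E ⥤ RightHeart E := (toLeftHeart Eᵒᵖ).rightOp

end RightHeart

/-! ### Torsion pairs -/

/-- A torsion pair in an abelian category: two strictly full subcategories such that there are no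
nonzero morphisms from torsion objects to torsion-free objects, and every object `X` fits in
an exact sequence `0 ⟶ T ⟶ X ⟶ F ⟶ 0` with `T` torsion and `F` torsion-free (this sequence is
unique up to unique isomorphism because of the first condition). -/
structure TorsionPair (C : Type u) [Category.{v} C] [Abelian C] where
  /-- The torsion objects. -/
  torsion : ObjectProperty C
  /-- The torsion-free objects. -/
  free : ObjectProperty C
  [torsion_isClosedUnderIsomorphisms : torsion.IsClosedUnderIsomorphisms]
  [free_isClosedUnderIsomorphisms : free.IsClosedUnderIsomorphisms]
  hom_eq_zero : ∀ {T F : C}, torsion T → free F → ∀ f : T ⟶ F, f = 0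
  exists_shortExact : ∀ X : C, ∃ (T F : C) (i : T ⟶ X) (p : X ⟶ F) (zero : i ≫ p = 0),
    torsion T ∧ free F ∧ (ShortComplex.mk i p zero).ShortExact

namespace TorsionPair

variable {C : Type u} [Category.{v} C] [Abelian C] (t : TorsionPair C)

/-- The torsion pair is tilting if every object is a subobject of a torsion object. -/
def IsTilting : Prop := ∀ X : C, ∃ (T : C) (i : X ⟶ T), t.torsion T ∧ Mono i

/-- The torsion pair is cotilting if every object is a quotient of a torsion-free object. -/
def IsCotilting : Prop := ∀ X : C, ∃ (F : C) (p : F ⟶ X), t.free F ∧ Epi p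

end TorsionPair

end QuasiAbelian

end

open QuasiAbelian

/-!
In an additive category with kernels and cokernels, strict epimorphisms and monomorphisms are the
regular ones. If `E` embeds in an abelian category `C` as the torsion-free class of a torsion pair,
then a morphism of `E` is a strict epimorphism exactly when it is an epimorphism in `C`, and a
sequence is strictly exact in `E` exactly when it is exact in `C`; as the torsion-free class is
closed under subobjects and extensions, `E` is quasi-abelian. If the torsion pair is cotilting,
every unbounded complex in `C` receives an epimorphism from a complex in `E`, whose kernel is again
in `E`, so that the cone of this kernel inclusion is a resolution by a complex in `E`. Therefore
`D(E) ⥤ D(C)` is fully faithful, and it identifies `LH(E)` with the objects of `D(C)` with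
cohomology only in degree `0`, i.e. with `C`.

Conversely, let `E` be quasi-abelian, and embed it in the abelian sheaves for the topology of
regular epimorphisms. The quotients of representable sheaves by representable subsheaves are stable
under kernels and cokernels. In the abelian category they form, the cokernel of `f : X₁ ⟶ X₀` has
torsion-free quotient `coker f`, computed in `E`. The statements about tilting pairs are dual.
-/

noncomputable section

namespace QuasiAbelian

/-! ### Strict morphisms as regular epimorphisms and monomorphisms -/

section Regular

variable {E : Type u} [Category.{v} E]

theorem isRegularEpi_comp_isIso_iff {X Y Z : E} (f : X ⟶ Y) (g : Y ⟶ Z) [IsIso g] :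
    IsRegularEpi (f ≫ g) ↔ IsRegularEpi f :=
  (MorphismProperty.regularEpi E).cancel_right_of_respectsIso f g

theorem isRegularEpi_map {E' : Type w} [Category.{w'} E'] (F : E ⥤ E')
    [PreservesColimitsOfShape WalkingParallelPair F] {X Y : E} (f : X ⟶ Y) [IsRegularEpi f] :
    IsRegularEpi (F.map f) := by
  let s := IsRegularEpi.getStruct f
  exact ⟨⟨{ W := _, left := F.map s.left, right := F.map s.right
            w := by rw [← F.map_comp, s.w, F.map_comp]
            isColimit := isColimitCoforkMapOfIsColimit F s.w s.isColimit }⟩⟩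

theorem isRegularEpi_map_iff {E' : Type w} [Category.{w'} E'] (F : E ⥤ E') [F.IsEquivalence]
    {X Y : E} (f : X ⟶ Y) : IsRegularEpi (F.map f) ↔ IsRegularEpi f := by
  refine ⟨fun _ => ?_, fun _ => isRegularEpi_map F f⟩
  exact ((MorphismProperty.regularEpi E).arrow_mk_iso_iff
    (((Functor.mapArrowFunctor _ _).mapIso F.asEquivalence.unitIso).app (Arrow.mk f))).2
      (isRegularEpi_map F.inv (F.map f))

theorem isRegularMono_map_iff {E' : Type w} [Category.{w'} E'] (F : E ⥤ E') [F.IsEquivalence]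
    {X Y : E} (f : X ⟶ Y) : IsRegularMono (F.map f) ↔ IsRegularMono f := by
  rw [← isRegularEpi_op_iff_isRegularMono, ← isRegularEpi_op_iff_isRegularMono]
  exact isRegularEpi_map_iff F.op f.op

variable [Preadditive E]

theorem nonempty_normalEpi_of_isRegularEpi {X Y : E} (f : X ⟶ Y) [IsRegularEpi f] :
    Nonempty (NormalEpi f) :=
  let s := IsRegularEpi.getStruct f
  ⟨{ W := s.W, g := s.left - s.right
     w := by rw [Preadditive.sub_comp, s.w, sub_self]
     isColimit := Preadditive.isColimitCokernelCoforkOfCofork s.isColimit }⟩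

theorem nonempty_normalMono_of_isRegularMono {X Y : E} (f : X ⟶ Y) [IsRegularMono f] :
    Nonempty (NormalMono f) :=
  let s := IsRegularMono.getStruct f
  ⟨{ Z := s.Z, g := s.left - s.right
     w := by rw [Preadditive.comp_sub, s.w, sub_self]
     isLimit := Preadditive.isLimitKernelForkOfFork s.isLimit }⟩

theorem isRegularEpi_comp_iff_isIso {X Y Z : E} (f : X ⟶ Y) (g : Y ⟶ Z) [IsRegularEpi f]
    (H : ∀ {W : E} (k : W ⟶ X), k ≫ f ≫ g = 0 → k ≫ f = 0) :
    IsRegularEpi (f ≫ g) ↔ IsIso g := by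
  refine ⟨fun _ => ?_, fun _ => (isRegularEpi_comp_isIso_iff f g).2 ‹_›⟩
  obtain ⟨_⟩ := nonempty_normalEpi_of_isRegularEpi (f ≫ g)
  obtain ⟨l, hl⟩ := NormalEpi.desc' (f ≫ g) f (H _ NormalEpi.w)
  have hf : Epi f := (IsRegularEpi.getStruct f).epi
  have hfg : Epi (f ≫ g) := (IsRegularEpi.getStruct (f ≫ g)).epi
  refine ⟨l, ?_, ?_⟩
  · rw [← cancel_epi f, ← Category.assoc, hl, Category.comp_id]
  · rw [← cancel_epi (f ≫ g), ← Category.assoc, hl, Category.comp_id]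

theorem isRegularMono_comp_iff_isIso {X Y Z : E} (f : X ⟶ Y) (g : Y ⟶ Z) [IsRegularMono g]
    (H : ∀ {W : E} (k : Z ⟶ W), (f ≫ g) ≫ k = 0 → g ≫ k = 0) :
    IsRegularMono (f ≫ g) ↔ IsIso f := by
  have := (isRegularEpi_op_iff_isRegularMono g).2 ‹_›
  rw [← isRegularEpi_op_iff_isRegularMono, op_comp, isRegularEpi_comp_iff_isIso, isIso_op_iff]
  intro W k hk
  exact Quiver.Hom.unop_inj (H k.unop (Quiver.Hom.op_inj hk))

variable [HasKernels E] [HasCokernels E]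

theorem comp_coimage_π_eq_zero {W X Y : E} (f : X ⟶ Y) (k : W ⟶ X) (hk : k ≫ f = 0) :
    k ≫ Abelian.coimage.π f = 0 := by
  rw [← kernel.lift_ι f k hk, Category.assoc, cokernel.condition, comp_zero]

theorem image_ι_comp_eq_zero {W X Y : E} (f : X ⟶ Y) (k : Y ⟶ W) (hk : f ≫ k = 0) :
    Abelian.image.ι f ≫ k = 0 := by
  rw [← cokernel.π_desc f k hk, kernel.condition_assoc, zero_comp]

theorem isStrict_iff_isRegularEpi {X Y : E} (f : X ⟶ Y) [Epi f] :
    IsStrict f ↔ IsRegularEpi f := by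
  have fac := Abelian.coimage_image_factorisation f
  have key : IsRegularEpi (Abelian.coimage.π f ≫ Abelian.coimageImageComparison f ≫
      Abelian.image.ι f) ↔ IsIso (Abelian.coimageImageComparison f ≫ Abelian.image.ι f) :=
    isRegularEpi_comp_iff_isIso _ _ fun k hk => comp_coimage_π_eq_zero f k (by rwa [fac] at hk)
  have : IsIso (Abelian.image.ι f) :=
    equalizer.ι_of_eq ((cancel_epi f).1 ((cokernel.condition f).trans comp_zero.symm))
  rw [fac, isIso_comp_right_iff] at key
  exact key.symm

theorem isStrict_iff_isRegularMono {X Y : E} (f : X ⟶ Y) [Mono f] :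
    IsStrict f ↔ IsRegularMono f := by
  have fac := Abelian.coimage_image_factorisation f
  rw [← Category.assoc] at fac
  have key : IsRegularMono ((Abelian.coimage.π f ≫ Abelian.coimageImageComparison f) ≫
      Abelian.image.ι f) ↔ IsIso (Abelian.coimage.π f ≫ Abelian.coimageImageComparison f) :=
    isRegularMono_comp_iff_isIso _ _ fun k hk => image_ι_comp_eq_zero f k (by rwa [fac] at hk)
  have : IsIso (Abelian.coimage.π f) :=
    coequalizer.π_of_eq ((cancel_mono f).1 ((kernel.condition f).trans zero_comp.symm))
  rw [fac, isIso_comp_left_iff] at key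
  exact key.symm

theorem isStrictEpi_iff {X Y : E} (f : X ⟶ Y) : IsStrictEpi f ↔ IsRegularEpi f := by
  constructor
  · rintro ⟨_, h⟩
    exact (isStrict_iff_isRegularEpi f).1 h
  · intro h
    have : Epi f := (IsRegularEpi.getStruct f).epi
    exact ⟨this, (isStrict_iff_isRegularEpi f).2 h⟩

theorem isStrictMono_iff {X Y : E} (f : X ⟶ Y) : IsStrictMono f ↔ IsRegularMono f := by
  constructor
  · rintro ⟨_, h⟩
    exact (isStrict_iff_isRegularMono f).1 h
  · intro h
    have : Mono f := (IsRegularMono.getStruct f).mono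
    exact ⟨this, (isStrict_iff_isRegularMono f).2 h⟩

theorem isIso_kernel_lift_image_ι (S : ShortComplex E) [Epi (kernel.lift S.g S.f S.zero)] :
    IsIso (kernel.lift S.g (Abelian.image.ι S.f) (image_ι_comp_g_eq_zero S)) := by
  have w : kernel.ι S.g ≫ cokernel.π S.f = 0 := by
    rw [← cancel_epi (kernel.lift S.g S.f S.zero), kernel.lift_ι_assoc, cokernel.condition,
      comp_zero]
  refine ⟨kernel.lift _ (kernel.ι S.g) w, ?_, ?_⟩
  · rw [← cancel_mono (Abelian.image.ι S.f)]
    simp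
  · rw [← cancel_mono (kernel.ι S.g)]
    simp

theorem strictlyExact_iff (S : ShortComplex E) :
    StrictlyExact S ↔ IsRegularEpi (kernel.lift S.g S.f S.zero) := by
  let c := kernel.lift S.g (Abelian.image.ι S.f) (image_ι_comp_g_eq_zero S)
  have fac : Abelian.coimage.π S.f ≫ Abelian.coimageImageComparison S.f ≫ c =
      kernel.lift S.g S.f S.zero := by
    rw [← cancel_mono (kernel.ι S.g)]
    simp [c]
  have key : IsRegularEpi (Abelian.coimage.π S.f ≫ Abelian.coimageImageComparison S.f ≫ c) ↔
      IsIso (Abelian.coimageImageComparison S.f ≫ c) :=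
    isRegularEpi_comp_iff_isIso _ _ fun k hk => comp_coimage_π_eq_zero S.f k (by
      rw [← kernel.lift_ι S.g S.f S.zero, ← fac, ← Category.assoc, hk, zero_comp])
  rw [← fac, key]
  constructor
  · rintro ⟨h₁ : IsIso _, h₂ : IsIso c⟩
    infer_instance
  · intro h
    have : Epi (kernel.lift S.g S.f S.zero) := by rw [← fac]; infer_instance
    have hc : IsIso c := isIso_kernel_lift_image_ι S
    exact ⟨(isIso_comp_right_iff _ c).1 h, hc⟩

end Regular

/-! ### Duality and invariance under equivalence -/

section IsQuasiAbelian

variable {E : Type u} [Category.{v} E] [Preadditive E] [HasZeroObject E] [HasBinaryBiproducts E]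

theorem isQuasiAbelian_of_isRegularEpi [HasKernels E] [HasCokernels E]
    (h₁ : ∀ {P X Y Z : E} {fst : P ⟶ X} {snd : P ⟶ Y} {f : X ⟶ Z} {g : Y ⟶ Z},
      IsPullback fst snd f g → IsRegularEpi g → IsRegularEpi fst)
    (h₂ : ∀ {Z X Y P : E} {f : Z ⟶ X} {g : Z ⟶ Y} {inl : X ⟶ P} {inr : Y ⟶ P},
      IsPushout f g inl inr → IsRegularMono f → IsRegularMono inr) : IsQuasiAbelian E where
  isStrictEpi_of_isPullback sq hg := (isStrictEpi_iff _).2 (h₁ sq ((isStrictEpi_iff _).1 hg))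
  isStrictMono_of_isPushout sq hf := (isStrictMono_iff _).2 (h₂ sq ((isStrictMono_iff _).1 hf))

namespace IsQuasiAbelian

variable [IsQuasiAbelian E]

theorem isRegularEpi_of_isPullback {P X Y Z : E} {fst : P ⟶ X} {snd : P ⟶ Y} {f : X ⟶ Z}
    {g : Y ⟶ Z} (sq : IsPullback fst snd f g) (hg : IsRegularEpi g) : IsRegularEpi fst :=
  (isStrictEpi_iff _).1 (isStrictEpi_of_isPullback sq ((isStrictEpi_iff _).2 hg))

theorem isRegularMono_of_isPushout {Z X Y P : E} {f : Z ⟶ X} {g : Z ⟶ Y} {inl : X ⟶ P}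
    {inr : Y ⟶ P} (sq : IsPushout f g inl inr) (hf : IsRegularMono f) : IsRegularMono inr :=
  (isStrictMono_iff _).1 (isStrictMono_of_isPushout sq ((isStrictMono_iff _).2 hf))

variable (E) in
theorem op : IsQuasiAbelian Eᵒᵖ := by
  refine isQuasiAbelian_of_isRegularEpi (fun sq hg => ?_) (fun sq hf => ?_)
  · rw [← isRegularMono_unop_iff_isRegularEpi] at hg ⊢
    exact isRegularMono_of_isPushout sq.unop hg
  · rw [← isRegularEpi_unop_iff_isRegularMono] at hf ⊢
    exact isRegularEpi_of_isPullback sq.unop hf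

theorem of_equivalence {E' : Type w} [Category.{w'} E'] [Preadditive E']
    [HasZeroObject E'] [HasBinaryBiproducts E'] (e : E ≌ E') : IsQuasiAbelian E' := by
  have : HasEqualizers E := Preadditive.hasEqualizers_of_hasKernels
  have : HasCoequalizers E := Preadditive.hasCoequalizers_of_hasCokernels
  have : HasEqualizers E' := Adjunction.hasLimitsOfShape_of_equivalence e.inverse
  have : HasCoequalizers E' := Adjunction.hasColimitsOfShape_of_equivalence e.inverse
  refine isQuasiAbelian_of_isRegularEpi (fun sq hg => ?_) (fun sq hf => ?_)
  · rw [← isRegularEpi_map_iff e.inverse] at hg ⊢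
    exact isRegularEpi_of_isPullback (sq.map e.inverse) hg
  · rw [← isRegularMono_map_iff e.inverse] at hf ⊢
    exact isRegularMono_of_isPushout (sq.map e.inverse) hf

end IsQuasiAbelian

variable (E) in
theorem isQuasiAbelian_op_iff : IsQuasiAbelian Eᵒᵖ ↔ IsQuasiAbelian E :=
  ⟨fun _ => have := IsQuasiAbelian.op Eᵒᵖ; .of_equivalence (opOpEquivalence E),
    fun _ => IsQuasiAbelian.op E⟩

end IsQuasiAbelian

/-! ### Torsion-free embeddings -/

section Embedding

variable {E : Type u} [Category.{v} E] {C : Type w} [Category.{w'} C] [Abelian C]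

/-- A functor whose essential image is closed under subobjects and extensions and such that every
object has an epimorphic reflection in it. For a fully faithful functor, this says that the
essential image is the torsion-free class of a torsion pair; the reflection is the torsion-free
quotient. -/
structure IsTorsionFreeEmbedding (i : E ⥤ C) : Prop where
  of_mono : ∀ {A : C} {X : E} (m : A ⟶ i.obj X) [Mono m], i.essImage A
  of_shortExact : ∀ {S : ShortComplex C}, S.ShortExact → i.essImage S.X₁ → i.essImage S.X₃ →
    i.essImage S.X₂
  exists_reflection : ∀ A : C, ∃ (X : E) (r : A ⟶ i.obj X), Epi r ∧
    ∀ {Z : E} (φ : A ⟶ i.obj Z), ∃ ψ, r ≫ ψ = φ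

namespace IsTorsionFreeEmbedding

variable [Preadditive E] {i : E ⥤ C} [i.Full] [i.Faithful] [i.Additive]
  (hi : IsTorsionFreeEmbedding i)

include hi

theorem exists_isLimit_kernelFork {X Y : E} (f : X ⟶ Y) :
    ∃ (c : KernelFork f), Nonempty (IsLimit c) ∧ Nonempty (IsLimit (i.mapCone c)) := by
  obtain ⟨K, ⟨e⟩⟩ := hi.of_mono (kernel.ι (i.map f))
  let k : K ⟶ X := i.preimage (e.hom ≫ kernel.ι (i.map f))
  have hk : i.map k = e.hom ≫ kernel.ι (i.map f) := i.map_preimage _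
  have w : k ≫ f = 0 := i.map_injective (by simp [hk])
  have hl : IsLimit (i.mapCone (KernelFork.ofι k w)) := by
    refine (KernelFork.isLimitMapConeEquiv _ _).symm ?_
    exact IsLimit.ofIsoLimit (kernelIsKernel (i.map f)) (Fork.ext e.symm (by
      change e.inv ≫ i.map k = kernel.ι (i.map f)
      rw [hk, e.inv_hom_id_assoc]))
  exact ⟨KernelFork.ofι k w, ⟨isLimitOfReflects i hl⟩, ⟨hl⟩⟩

theorem hasKernels : HasKernels E where
  has_limit f := by
    obtain ⟨c, ⟨hc⟩, _⟩ := hi.exists_isLimit_kernelFork f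
    exact ⟨⟨_, hc⟩⟩

theorem preservesKernel {X Y : E} (f : X ⟶ Y) : PreservesLimit (parallelPair f 0) i := by
  obtain ⟨c, ⟨hc⟩, ⟨hc'⟩⟩ := hi.exists_isLimit_kernelFork f
  exact preservesLimit_of_preserves_limit_cone hc hc'

theorem hasCokernels : HasCokernels E where
  has_colimit {X Y} f := by
    obtain ⟨Q, r, hr, H⟩ := hi.exists_reflection (cokernel (i.map f))
    let q : Y ⟶ Q := i.preimage (cokernel.π (i.map f) ≫ r)
    have hq : i.map q = cokernel.π (i.map f) ≫ r := i.map_preimage _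
    have : Epi q := i.epi_of_epi_map (by rw [hq]; infer_instance)
    have exists_desc {Z : E} (h : Y ⟶ Z) (hh : f ≫ h = 0) : ∃ l, q ≫ l = h := by
      obtain ⟨ψ, hψ⟩ := H (cokernel.desc (i.map f) (i.map h) (by
        rw [← i.map_comp, hh, i.map_zero]))
      exact ⟨i.preimage ψ, i.map_injective (by simp [hq, hψ])⟩
    exact ⟨⟨_, CokernelCofork.IsColimit.ofπ' q (i.map_injective (by simp [hq]))
      fun h hh => ⟨_, (exists_desc h hh).choose_spec⟩⟩⟩

theorem preservesFiniteLimits [HasZeroObject E] [HasBinaryBiproducts E] :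
    PreservesFiniteLimits i := by
  have := hi.hasKernels
  have {X Y : E} (f : X ⟶ Y) := hi.preservesKernel f
  have : HasEqualizers E := Preadditive.hasEqualizers_of_hasKernels
  have : HasFiniteProducts E := hasFiniteProducts_of_has_binary_and_terminal
  exact i.preservesFiniteLimits_of_preservesKernels

theorem isRegularEpi_iff {X Y : E} (f : X ⟶ Y) : IsRegularEpi f ↔ Epi (i.map f) := by
  constructor
  · intro hf
    obtain ⟨I, ⟨a⟩⟩ := hi.of_mono (Abelian.image.ι (i.map f))
    let m : I ⟶ Y := i.preimage (a.hom ≫ Abelian.image.ι (i.map f))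
    let p : X ⟶ I := i.preimage (Abelian.factorThruImage (i.map f) ≫ a.inv)
    have fac : p ≫ m = f := i.map_injective (by simp [p, m])
    have : Mono m := i.mono_of_mono_map (by simp only [m, i.map_preimage]; infer_instance)
    have hm : IsIso m := ExtremalEpi.isIso f p m fac
    have hp : Epi (i.map p) := by simp only [p, i.map_preimage]; infer_instance
    rw [← fac, i.map_comp]
    infer_instance
  · intro hf
    have := hi.hasKernels
    have := hi.preservesKernel f
    have hc : IsColimit (CokernelCofork.ofπ (i.map f) (f := i.map (kernel.ι f)) _) :=
      Abelian.epiIsCokernelOfKernel _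
        (isLimitForkMapOfIsLimit' i (kernel.condition f) (kernelIsKernel f))
    have : NormalEpi f :=
      { W := kernel f
        g := kernel.ι f
        w := kernel.condition f
        isColimit := isColimitOfReflects i
          ((CokernelCofork.isColimitMapCoconeEquiv (.ofπ f (kernel.condition f)) i).symm hc) }
    infer_instance

theorem isRegularMono_iff {X Y : E} (f : X ⟶ Y) :
    IsRegularMono f ↔ Mono (i.map f) ∧ i.essImage (cokernel (i.map f)) := by
  constructor
  · intro hf
    obtain ⟨N⟩ := nonempty_normalMono_of_isRegularMono f
    have := hi.preservesKernel N.g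
    have hl := isLimitForkMapOfIsLimit' i N.w N.isLimit
    have w : i.map f ≫ i.map N.g = 0 := by rw [← i.map_comp, N.w, i.map_zero]
    have : Mono (cokernel.desc _ _ w) := (ShortComplex.exact_iff_mono_cokernel_desc _).1
      ((ShortComplex.mk _ _ w).exact_of_f_is_kernel hl)
    exact ⟨mono_of_isLimit_fork hl, hi.of_mono (cokernel.desc _ _ w)⟩
  · rintro ⟨hm, W, ⟨e⟩⟩
    let g : Y ⟶ W := i.preimage (cokernel.π (i.map f) ≫ e.inv)
    have hg : i.map g = cokernel.π (i.map f) ≫ e.inv := i.map_preimage _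
    have w : f ≫ g = 0 := i.map_injective (by simp [hg])
    have hl : IsLimit (KernelFork.ofι (i.map f) (f := i.map g) _) :=
      isKernelCompMono (Abelian.monoIsKernelOfCokernel _ (cokernelIsCokernel (i.map f))) e.inv hg
    have : NormalMono f :=
      { Z := W
        g
        w
        isLimit := isLimitOfReflects i ((KernelFork.isLimitMapConeEquiv (.ofι f w) i).symm hl) }
    infer_instance

theorem essImage_pushout {X Y Z : E} (f : Z ⟶ X) (g : Z ⟶ Y) [IsRegularMono f] :
    i.essImage (pushout (i.map f) (i.map g)) := by
  obtain ⟨hf, hf'⟩ := (hi.isRegularMono_iff f).1 ‹_›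
  have := isIso_cokernel_map_of_isPushout (.of_hasPushout (i.map f) (i.map g))
  let S := ShortComplex.mk (pushout.inr (i.map f) (i.map g)) (cokernel.π _) (cokernel.condition _)
  have hS : S.ShortExact :=
    { exact := ShortComplex.exact_cokernel _
      mono_f := inferInstanceAs (Mono (pushout.inr _ _))
      epi_g := inferInstanceAs (Epi (cokernel.π _)) }
  exact hi.of_shortExact hS ⟨Y, ⟨Iso.refl _⟩⟩
    (i.essImage.prop_of_iso (asIso (cokernel.map _ _ _ _ pushout.condition)) hf')

theorem preservesColimit_span {X Y Z : E} (f : Z ⟶ X) (g : Z ⟶ Y) [IsRegularMono f] :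
    PreservesColimit (span f g) i := by
  have : HasColimit (span f g ⋙ i) := hasColimit_of_iso (spanCompIso i f g)
  obtain ⟨P, ⟨e⟩⟩ := hi.essImage_pushout f g
  have : CreatesColimit (span f g) i := createsColimitOfFullyFaithfulOfIso P
    (e ≪≫ (HasColimit.isoOfNatIso (spanCompIso i f g)).symm)
  infer_instance

theorem isRegularMono_of_isPushout {Z X Y P : E} {f : Z ⟶ X} {g : Z ⟶ Y} {inl : X ⟶ P}
    {inr : Y ⟶ P} (sq : IsPushout f g inl inr) [IsRegularMono f] : IsRegularMono inr := by
  obtain ⟨hf, hf'⟩ := (hi.isRegularMono_iff f).1 ‹_›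
  have := hi.preservesColimit_span f g
  have := isIso_cokernel_map_of_isPushout (sq.map i)
  exact (hi.isRegularMono_iff inr).2
    ⟨(MorphismProperty.monomorphisms C).of_isPushout (sq.map i).flip hf,
      i.essImage.prop_of_iso (asIso (cokernel.map _ _ _ _ (sq.map i).w)) hf'⟩

theorem isQuasiAbelian [HasZeroObject E] [HasBinaryBiproducts E] : IsQuasiAbelian E := by
  have := hi.hasKernels
  have := hi.hasCokernels
  have := hi.preservesFiniteLimits
  refine isQuasiAbelian_of_isRegularEpi (fun sq hg => ?_)
    (fun sq _ => hi.isRegularMono_of_isPushout sq)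
  rw [hi.isRegularEpi_iff] at hg ⊢
  exact (MorphismProperty.epimorphisms C).of_isPullback (sq.map i).flip hg

theorem strictlyExact_iff [HasKernels E] [HasCokernels E] (S : ShortComplex E) :
    StrictlyExact S ↔ (S.map i).Exact := by
  have := hi.preservesKernel S.g
  have fac : i.map (kernel.lift S.g S.f S.zero) ≫ (PreservesKernel.iso i S.g).hom =
      kernel.lift (S.map i).g (S.map i).f (S.map i).zero := by
    rw [PreservesKernel.iso_hom]
    exact map_lift_kernelComparison S.g i S.zero
  rw [QuasiAbelian.strictlyExact_iff, hi.isRegularEpi_iff, ShortComplex.exact_iff_epi_kernel_lift,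
    ← fac]
  exact ((MorphismProperty.epimorphisms C).cancel_right_of_respectsIso _
    (PreservesKernel.iso i S.g).hom).symm

end IsTorsionFreeEmbedding

end Embedding

/-! ### Resolutions of unbounded complexes -/

section Resolution

open CochainComplex HomComplex

variable {E : Type u} [Category.{v} E] [Preadditive E]
  {C : Type w} [Category.{w'} C] [Abelian C]

theorem exists_mapHomologicalComplex_iso (i : E ⥤ C) [i.Full] [i.Faithful] [i.Additive]
    (M : CochainComplex C ℤ) (hM : ∀ n, i.essImage (M.X n)) :
    ∃ L : CochainComplex E ℤ,
      Nonempty ((i.mapHomologicalComplex (ComplexShape.up ℤ)).obj L ≅ M) := by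
  choose X e using hM
  replace e n := (e n).some
  let L : CochainComplex E ℤ :=
    { X := X
      d := fun p q => i.preimage ((e p).hom ≫ M.d p q ≫ (e q).inv)
      shape := fun p q h => i.map_injective (by simp [M.shape p q h])
      d_comp_d' := fun p q r _ _ => i.map_injective (by simp) }
  exact ⟨L, ⟨HomologicalComplex.Hom.isoOfComponents e fun p q _ => by
    change (e p).hom ≫ M.d p q = i.map (i.preimage _) ≫ (e q).hom
    rw [i.map_preimage, Category.assoc, Category.assoc, (e q).inv_hom_id, Category.comp_id]⟩⟩

theorem essImage_biprod (i : E ⥤ C) [i.Additive] [HasBinaryBiproducts E] {A B : C}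
    (hA : i.essImage A) (hB : i.essImage B) : i.essImage (A ⊞ B) := by
  obtain ⟨X, ⟨a⟩⟩ := hA
  obtain ⟨Y, ⟨b⟩⟩ := hB
  have := preservesBinaryBiproducts_of_preservesBiproducts i
  exact ⟨X ⊞ Y, ⟨i.mapBiprod X Y ≪≫ biprod.mapIso a b⟩⟩

theorem mappingCone_X_of_biprod (P : ObjectProperty C) [P.IsClosedUnderIsomorphisms]
    (hP : ∀ {A B : C}, P A → P B → P (A ⊞ B)) {K L : CochainComplex C ℤ} (f : K ⟶ L)
    (hK : ∀ n, P (K.X n)) (hL : ∀ n, P (L.X n)) (n : ℤ) : P ((mappingCone f).X n) :=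
  P.prop_of_iso (HomologicalComplex.homotopyCofiber.XIsoBiprod f n (n + 1) rfl).symm
    (hP (hK _) (hL _))

-- A complex `G` with zero differential maps to `K` by any cochain of degree `-1` once it is
-- replaced by the cone of its identity, whose degree `n` term is `G (n + 1) ⊞ G n`.
theorem exists_epi_f_of_exists_epi (P : ObjectProperty C) [P.IsClosedUnderIsomorphisms]
    (hP : ∀ {A B : C}, P A → P B → P (A ⊞ B)) (hP' : ∀ A : C, ∃ (F : C) (p : F ⟶ A), P F ∧ Epi p)
    (K : CochainComplex C ℤ) :
    ∃ (T : CochainComplex C ℤ) (f : T ⟶ K), (∀ n, P (T.X n)) ∧ ∀ n, Epi (f.f n) := by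
  choose F p hF hp using fun n => hP' (K.X (n - 1))
  let G : CochainComplex C ℤ := { X := F, d := fun _ _ => 0 }
  let α : Cochain G K (-1) := Cochain.mk fun a b h =>
    p a ≫ (K.XIsoOfEq (show a - 1 = b by lia)).hom
  let β : G ⟶ K := Cocycle.homOf (Cocycle.mk (δ (-1) 0 α) 1 (by simp) (δ_δ _ _ _ _))
  refine ⟨mappingCone (𝟙 G), mappingCone.desc (𝟙 G) α β (by simp [β]),
    mappingCone_X_of_biprod P hP _ hF hF, fun n => ?_⟩
  have : Epi (α.v (n + 1) n (by lia)) := by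
    simp only [α, Cochain.mk_v]
    infer_instance
  exact epi_of_epi_fac (mappingCone.inl_v_desc_f (𝟙 G) α β _ (n + 1) n _)

namespace IsTorsionFreeEmbedding

variable [HasBinaryBiproducts E] {i : E ⥤ C} [i.Full] [i.Faithful] [i.Additive]
  (hi : IsTorsionFreeEmbedding i) (hi' : ∀ A : C, ∃ (X : E) (p : i.obj X ⟶ A), Epi p)

include hi hi'

theorem exists_quasiIso (K : CochainComplex C ℤ) :
    ∃ (L : CochainComplex E ℤ) (f : (i.mapHomologicalComplex (ComplexShape.up ℤ)).obj L ⟶ K),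
      QuasiIso f := by
  obtain ⟨T, f, hT, hf⟩ := exists_epi_f_of_exists_epi i.essImage (essImage_biprod i) (fun A =>
    let ⟨X, p, hp⟩ := hi' A
    ⟨_, p, i.obj_mem_essImage X, hp⟩) K
  have : Epi f := HomologicalComplex.epi_of_epi_f f hf
  let S : ShortComplex (CochainComplex C ℤ) := ShortComplex.mk (kernel.ι f) f (kernel.condition f)
  have hS : S.ShortExact := { exact := ShortComplex.exact_kernel f }
  have hN (n : ℤ) : i.essImage ((kernel f).X n) := by
    obtain ⟨X, ⟨e⟩⟩ := hT n
    exact hi.of_mono ((kernel.ι f).f n ≫ e.inv)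
  obtain ⟨L, ⟨e⟩⟩ := exists_mapHomologicalComplex_iso i (mappingCone S.f)
    (mappingCone_X_of_biprod i.essImage (essImage_biprod i) S.f hN hT)
  have := mappingCone.quasiIso_descShortComplex hS
  exact ⟨L, e.hom ≫ mappingCone.descShortComplex S, inferInstance⟩

theorem exists_trW (Y : HomotopyCategory C (ComplexShape.up ℤ)) :
    ∃ (X : HoCat E) (s : (i.mapHomotopyCategory (ComplexShape.up ℤ)).obj X ⟶ Y),
      (HomotopyCategory.subcategoryAcyclic C).trW s := by
  obtain ⟨K, rfl⟩ := HomotopyCategory.quotient_obj_surjective Y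
  obtain ⟨L, f, hf⟩ := hi.exists_quasiIso hi' K
  refine ⟨(HomotopyCategory.quotient E (ComplexShape.up ℤ)).obj L,
    (HomotopyCategory.quotient C (ComplexShape.up ℤ)).map f, ?_⟩
  rw [← HomotopyCategory.quasiIso_eq_trW_subcategoryAcyclic]
  exact (HomotopyCategory.quotient_map_mem_quasiIso_iff f).2 hf

end IsTorsionFreeEmbedding

end Resolution

/-! ### Localization of full subcategories admitting resolutions -/

section Localization

variable {K : Type*} [Category* K] {K' : Type*} [Category* K'] {D : Type*} [Category* D]
  {D' : Type*} [Category* D'] (F : K ⥤ K') [F.Full]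
  (W : MorphismProperty K) (W' : MorphismProperty K') (hW : W'.inverseImage F ≤ W)
  [W'.HasRightCalculusOfFractions]
  (L : K ⥤ D) [L.IsLocalization W] (L' : K' ⥤ D') [L'.IsLocalization W']
  (G : D ⥤ D') (e : L ⋙ G ≅ F ⋙ L')
  (hF : ∀ Y : K', ∃ (X : K) (s : F.obj X ⟶ Y), W' s)

include hW e hF

theorem full_of_resolutions : G.Full := by
  have : L.EssSurj := Localization.essSurj L W
  refine G.full_of_comp_essSurj L (fun X Y φ => ?_)
  obtain ⟨z, hz⟩ := Localization.exists_rightFraction L' W' (e.inv.app X ≫ φ ≫ e.hom.app Y)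
  obtain ⟨X', t, ht⟩ := hF z.X'
  obtain ⟨s, hs⟩ := F.map_surjective (t ≫ z.s)
  obtain ⟨a, ha⟩ := F.map_surjective (t ≫ z.f)
  have hsW : W s := hW _ (by
    rw [MorphismProperty.inverseImage_iff, hs]
    exact W'.comp_mem _ _ ht z.hs)
  have := Localization.inverts L W s hsW
  have key : L'.map (F.map s) ≫ e.inv.app X ≫ φ ≫ e.hom.app Y = L'.map (F.map a) := by
    rw [hz, hs, ha]
    simp
  refine ⟨inv (L.map s) ≫ L.map a, ?_⟩
  rw [← cancel_epi (G.map (L.map s)), ← G.map_comp, IsIso.hom_inv_id_assoc,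
    ← cancel_mono (e.hom.app Y)]
  calc G.map (L.map a) ≫ e.hom.app Y
      = e.hom.app X' ≫ L'.map (F.map a) := e.hom.naturality a
    _ = (e.hom.app X' ≫ L'.map (F.map s)) ≫ e.inv.app X ≫ φ ≫ e.hom.app Y := by
      rw [← key, Category.assoc]
    _ = (G.map (L.map s) ≫ e.hom.app X) ≫ e.inv.app X ≫ φ ≫ e.hom.app Y :=
      congrArg (· ≫ _) (e.hom.naturality s).symm
    _ = (G.map (L.map s) ≫ φ) ≫ e.hom.app Y := by simp

theorem faithful_of_resolutions [F.Faithful] [W.HasRightCalculusOfFractions] : G.Faithful := by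
  have map_eq_of_map_eq {X Y : K} (a b : X ⟶ Y) (hab : L'.map (F.map a) = L'.map (F.map b)) :
      L.map a = L.map b := by
    obtain ⟨Z, s, hs, fac⟩ := (MorphismProperty.map_eq_iff_precomp L' W' _ _).1 hab
    obtain ⟨X', t, ht⟩ := hF Z
    obtain ⟨u, hu⟩ := F.map_surjective (t ≫ s)
    have huW : W u := hW _ (by
      rw [MorphismProperty.inverseImage_iff, hu]
      exact W'.comp_mem _ _ ht hs)
    have := Localization.inverts L W u huW
    have hab' : u ≫ a = u ≫ b := F.map_injective (by
      rw [F.map_comp, F.map_comp, hu, Category.assoc, Category.assoc, fac])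
    rw [← cancel_epi (L.map u), ← L.map_comp, ← L.map_comp, hab']
  have : L.EssSurj := Localization.essSurj L W
  refine G.faithful_of_comp_essSurj L (fun X Y f g hfg => ?_)
  obtain ⟨z, hz⟩ := Localization.exists_rightFraction L W f
  obtain ⟨z', hz'⟩ := Localization.exists_rightFraction L W (L.map z.s ≫ g)
  have := Localization.inverts L W z.s z.hs
  have := Localization.inverts L W z'.s z'.hs
  have hf : L.map z'.s ≫ L.map z.s ≫ f = L.map (z'.s ≫ z.f) := by simp [hz]
  have hg : L.map z'.s ≫ L.map z.s ≫ g = L.map z'.f := by simp [hz']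
  rw [← cancel_epi (L.map z.s), ← cancel_epi (L.map z'.s), hf, hg]
  apply map_eq_of_map_eq
  rw [← cancel_epi (e.hom.app _)]
  refine (e.hom.naturality _).symm.trans (Eq.trans ?_ (e.hom.naturality _))
  simp only [Functor.comp_map, ← hf, ← hg, Functor.map_comp, hfg]

end Localization

/-! ### The left heart and the ambient abelian category of a cotilting torsion pair -/

section LeftHeartEquivalence

namespace IsTorsionFreeEmbedding

variable {E : Type u} [Category.{v} E] [Preadditive E] [HasKernels E] [HasCokernels E]
  {C : Type w} [Category.{w'} C] [Abelian C]
  {i : E ⥤ C} [i.Full] [i.Faithful] [i.Additive] (hi : IsTorsionFreeEmbedding i)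

include hi

theorem strictlyExactAt_iff (K : CochainComplex E ℤ) (n : ℤ) :
    StrictlyExactAt K n ↔ ((i.mapHomologicalComplex (ComplexShape.up ℤ)).obj K).ExactAt n :=
  hi.strictlyExact_iff (K.sc n)

theorem acyclic_eq_inverseImage :
    acyclic E = (HomotopyCategory.subcategoryAcyclic C).inverseImage
      (i.mapHomotopyCategory (ComplexShape.up ℤ)) := by
  have key (K : CochainComplex E ℤ) : (∀ n, StrictlyExactAt K n) ↔
      (HomotopyCategory.subcategoryAcyclic C).inverseImage
        (i.mapHomotopyCategory (ComplexShape.up ℤ))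
        ((HomotopyCategory.quotient E (ComplexShape.up ℤ)).obj K) := by
    simp only [hi.strictlyExactAt_iff]
    exact (HomotopyCategory.quotient_obj_mem_subcategoryAcyclic_iff_exactAt _).symm
  ext X
  constructor
  · rintro ⟨L, hL, ⟨e⟩⟩
    exact ObjectProperty.prop_of_iso _ e ((key L).1 hL)
  · intro hX
    obtain ⟨K, rfl⟩ := HomotopyCategory.quotient_obj_surjective X
    exact ⟨K, (key K).2 hX, ⟨Iso.refl _⟩⟩

variable [HasZeroObject E] [HasBinaryBiproducts E]

theorem trW_acyclic_eq_inverseImage :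
    (acyclic E).trW = (HomotopyCategory.subcategoryAcyclic C).trW.inverseImage
      (i.mapHomotopyCategory (ComplexShape.up ℤ)) := by
  ext X Y f
  rw [hi.acyclic_eq_inverseImage, ObjectProperty.inverseImage_trW_iff,
    MorphismProperty.inverseImage_iff]

section DerFunctor

variable [HasDerivedCategory C]

theorem isInvertedBy : (acyclic E).trW.IsInvertedBy
    (i.mapHomotopyCategory (ComplexShape.up ℤ) ⋙ DerivedCategory.Qh) := fun X Y f hf => by
  rw [hi.trW_acyclic_eq_inverseImage] at hf
  exact Localization.inverts DerivedCategory.Qh (HomotopyCategory.subcategoryAcyclic C).trW _ hf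

/-- The functor `D(E) ⥤ D(C)` induced by the embedding `i : E ⥤ C`. -/
def derFunctor : DerCat E ⥤ DerivedCategory C :=
  Localization.lift _ hi.isInvertedBy (acyclic E).trW.Q

def derFunctorFac : (acyclic E).trW.Q ⋙ hi.derFunctor ≅
    i.mapHomotopyCategory (ComplexShape.up ℤ) ⋙ DerivedCategory.Qh :=
  Localization.fac _ hi.isInvertedBy (acyclic E).trW.Q

def toDerCatCompDerFunctor : toDerCat E ⋙ hi.derFunctor ≅
    i.mapHomologicalComplex (ComplexShape.up ℤ) ⋙ DerivedCategory.Q :=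
  Functor.associator _ _ _ ≪≫ Functor.isoWhiskerLeft _ hi.derFunctorFac ≪≫
    (Functor.associator _ _ _).symm ≪≫
    Functor.isoWhiskerRight (i.mapHomotopyCategoryFactors (ComplexShape.up ℤ)) _ ≪≫
    Functor.associator _ _ _ ≪≫
    Functor.isoWhiskerLeft _ (DerivedCategory.quotientCompQhIso C)

def singleCompToDerCatCompDerFunctor :
    HomologicalComplex.single E (ComplexShape.up ℤ) 0 ⋙ toDerCat E ⋙ hi.derFunctor ≅
      i ⋙ DerivedCategory.singleFunctor C 0 :=
  Functor.isoWhiskerLeft _ hi.toDerCatCompDerFunctor ≪≫ (Functor.associator _ _ _).symm ≪≫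
    Functor.isoWhiskerRight (HomologicalComplex.singleMapHomologicalComplex i _ 0) _ ≪≫
    Functor.associator _ _ _ ≪≫
    Functor.isoWhiskerLeft i (DerivedCategory.singleFunctorIsoCompQ C 0).symm

theorem isLE_derFunctor_obj {X : DerCat E} (hX : leftLE E X) : (hi.derFunctor.obj X).IsLE 0 := by
  obtain ⟨L, hL, ⟨e⟩⟩ := hX
  have : ((i.mapHomologicalComplex (ComplexShape.up ℤ) ⋙ DerivedCategory.Q).obj L).IsLE 0 :=
    (DerivedCategory.isLE_Q_obj_iff _ 0).2 ((CochainComplex.isLE_iff _ 0).2 fun n hn =>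
      (hi.strictlyExactAt_iff L n).1 (hL n hn))
  exact DerivedCategory.TStructure.t.isLE_of_iso
    ((hi.toDerCatCompDerFunctor.app L).symm ≪≫ hi.derFunctor.mapIso e) 0

theorem isGE_derFunctor_obj {X : DerCat E} (hX : leftGE E X) : (hi.derFunctor.obj X).IsGE 0 := by
  obtain ⟨L, hL, ⟨e⟩⟩ := hX
  have : ((i.mapHomologicalComplex (ComplexShape.up ℤ) ⋙ DerivedCategory.Q).obj L).IsGE 0 :=
    (DerivedCategory.isGE_Q_obj_iff _ 0).2 ((CochainComplex.isGE_iff _ 0).2 fun n hn =>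
      (hi.strictlyExactAt_iff L n).1 (hL n hn))
  exact DerivedCategory.TStructure.t.isGE_of_iso
    ((hi.toDerCatCompDerFunctor.app L).symm ≪≫ hi.derFunctor.mapIso e) 0

theorem essImage_singleFunctor_derFunctor_obj (X : LeftHeart E) :
    (DerivedCategory.singleFunctor C 0).essImage (hi.derFunctor.obj X.obj) := by
  have := hi.isLE_derFunctor_obj X.property.1
  have := hi.isGE_derFunctor_obj X.property.2
  obtain ⟨A, ⟨e⟩⟩ := DerivedCategory.exists_iso_singleFunctor_obj_of_isGE_of_isLE
    (hi.derFunctor.obj X.obj) 0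
  exact ⟨A, ⟨e.symm⟩⟩

/-- The functor `LH(E) ⥤ C` induced by `D(E) ⥤ D(C)`, where `C` is identified with the complexes
concentrated in degree `0`. -/
def leftHeartFunctor : LeftHeart E ⥤ C :=
  Functor.essImage.liftFunctor ((leftLE E ⊓ leftGE E).ι ⋙ hi.derFunctor)
    (DerivedCategory.singleFunctor C 0) hi.essImage_singleFunctor_derFunctor_obj

def leftHeartFunctorCompIso : hi.leftHeartFunctor ⋙ DerivedCategory.singleFunctor C 0 ≅
    (leftLE E ⊓ leftGE E).ι ⋙ hi.derFunctor :=
  Functor.essImage.liftFunctorCompIso _ _ hi.essImage_singleFunctor_derFunctor_obj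

theorem nonempty_toLeftHeart_comp_iso :
    Nonempty (toLeftHeart E ⋙ hi.leftHeartFunctor ≅ i) :=
  ⟨Functor.fullyFaithfulCancelRight (DerivedCategory.singleFunctor C 0)
    (Functor.associator _ _ _ ≪≫ Functor.isoWhiskerLeft _ hi.leftHeartFunctorCompIso ≪≫
      hi.singleCompToDerCatCompDerFunctor)⟩

end DerFunctor

variable (hi' : ∀ A : C, ∃ (X : E) (p : i.obj X ⟶ A), Epi p)

include hi'

section

variable [HasDerivedCategory C]

theorem full_derFunctor : hi.derFunctor.Full :=
  full_of_resolutions _ _ _ hi.trW_acyclic_eq_inverseImage.ge _ DerivedCategory.Qh _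
    hi.derFunctorFac (hi.exists_trW hi')

theorem faithful_derFunctor : hi.derFunctor.Faithful := by
  have : (acyclic E).trW.HasRightCalculusOfFractions := by
    rw [hi.acyclic_eq_inverseImage]
    infer_instance
  exact faithful_of_resolutions _ _ _ hi.trW_acyclic_eq_inverseImage.ge _ DerivedCategory.Qh _
    hi.derFunctorFac (hi.exists_trW hi')

theorem exists_leftHeart_iso (A : C) :
    ∃ X : LeftHeart E, Nonempty (hi.derFunctor.obj X.obj ≅
      (DerivedCategory.singleFunctor C 0).obj A) := by
  obtain ⟨L, f, hf⟩ := hi.exists_quasiIso hi'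
    ((HomologicalComplex.single C (ComplexShape.up ℤ) 0).obj A)
  have hL (n : ℤ) (hn : n ≠ 0) : StrictlyExactAt L n := by
    rw [hi.strictlyExactAt_iff, exactAt_iff_of_quasiIsoAt f n]
    exact HomologicalComplex.exactAt_single_obj (ComplexShape.up ℤ) 0 A n hn
  have : IsIso (DerivedCategory.Q.map f) := (DerivedCategory.isIso_Q_map_iff_quasiIso C f).2 hf
  exact ⟨⟨(toDerCat E).obj L, ⟨L, fun n hn => hL n hn.ne', ⟨Iso.refl _⟩⟩,
    ⟨L, fun n hn => hL n hn.ne, ⟨Iso.refl _⟩⟩⟩,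
    ⟨hi.toDerCatCompDerFunctor.app L ≪≫ asIso (DerivedCategory.Q.map f) ≪≫
      ((DerivedCategory.singleFunctorIsoCompQ C 0).app A).symm⟩⟩

theorem isEquivalence_leftHeartFunctor : hi.leftHeartFunctor.IsEquivalence := by
  have := hi.full_derFunctor hi'
  have := hi.faithful_derFunctor hi'
  let Ψ := hi.leftHeartFunctor
  let S := DerivedCategory.singleFunctor C 0
  have : (Ψ ⋙ S).Full := Functor.Full.of_iso hi.leftHeartFunctorCompIso.symm
  have : (Ψ ⋙ S).Faithful := Functor.Faithful.of_iso hi.leftHeartFunctorCompIso.symm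
  exact
    { faithful := Functor.Faithful.of_comp Ψ S
      full := Functor.Full.of_comp_faithful Ψ S
      essSurj := ⟨fun A =>
        let ⟨X, ⟨e⟩⟩ := hi.exists_leftHeart_iso hi' A
        ⟨X, ⟨S.preimageIso (hi.leftHeartFunctorCompIso.app X ≪≫ e)⟩⟩⟩ }

end

theorem exists_leftHeart_equivalence :
    ∃ Φ : LeftHeart E ≌ C, Nonempty (toLeftHeart E ⋙ Φ.functor ≅ i) :=
  let := HasDerivedCategory.standard C
  have := hi.isEquivalence_leftHeartFunctor hi'
  ⟨hi.leftHeartFunctor.asEquivalence, hi.nonempty_toLeftHeart_comp_iso⟩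

end IsTorsionFreeEmbedding

end LeftHeartEquivalence

/-! ### Quotients of representable sheaves -/

section Quotients

section Pushout

variable {A : Type w} [Category.{w'} A] [Abelian A]

theorem isPushout_of_shortExact {S S' : ShortComplex A} (hS : S.ShortExact) (hS' : S'.ShortExact)
    (φ : S ⟶ S') [IsIso φ.τ₃] : IsPushout S.f φ.τ₁ φ.τ₂ S'.f := by
  have := hS.mono_f
  have := isIso_cokernel_map_of_isPushout (.of_hasPushout S.f φ.τ₁)
  let D := ShortComplex.mk (pushout.inr S.f φ.τ₁) (cokernel.π _) (cokernel.condition _)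
  have hD : D.ShortExact :=
    { exact := ShortComplex.exact_cokernel _
      mono_f := inferInstanceAs (Mono (pushout.inr _ _))
      epi_g := inferInstanceAs (Epi (cokernel.π _)) }
  let d : pushout S.f φ.τ₁ ⟶ S'.X₂ := pushout.desc φ.τ₂ S'.f φ.comm₁₂.symm
  have hinl : pushout.inl S.f φ.τ₁ ≫ d = φ.τ₂ := pushout.inl_desc _ _ _
  have hinr : pushout.inr S.f φ.τ₁ ≫ d = S'.f := pushout.inr_desc _ _ _
  have hd : pushout.inr S.f φ.τ₁ ≫ d ≫ S'.g = 0 := by rw [reassoc_of% hinr, S'.zero]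
  let ψ : D ⟶ S' :=
    { τ₁ := 𝟙 _
      τ₂ := d
      τ₃ := cokernel.desc _ (d ≫ S'.g) hd
      comm₁₂ := (Category.id_comp _).trans hinr.symm }
  let c : S.X₃ ≅ cokernel S.f :=
    IsColimit.coconePointUniqueUpToIso hS.gIsCokernel (colimit.isColimit _)
  have hc : S.g ≫ c.hom = cokernel.π S.f :=
    IsColimit.comp_coconePointUniqueUpToIso_hom hS.gIsCokernel (colimit.isColimit _) .one
  have fac : (c.hom ≫ cokernel.map _ _ _ _ pushout.condition) ≫ ψ.τ₃ = φ.τ₃ := by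
    have := hS.epi_g
    rw [← cancel_epi S.g, ← φ.comm₂₃, Category.assoc, reassoc_of% hc]
    simp [ψ, reassoc_of% hinl]
  have : IsIso ψ.τ₁ := inferInstanceAs (IsIso (𝟙 _))
  have : IsIso ψ.τ₃ := IsIso.of_isIso_fac_left fac
  have : IsIso d := ShortComplex.isIso₂_of_shortExact_of_isIso₁₃ ψ hD hS'
  exact .of_iso (.of_hasPushout S.f φ.τ₁) (Iso.refl _) (Iso.refl _) (Iso.refl _) (asIso d)
    (by simp) (by simp) (by simp [hinl]) (by simp [hinr])

end Pushout

section Preadditive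

variable {E : Type u} [Category.{v} E] [Preadditive E] [HasKernels E]

theorem exists_comp_eq_of_kernel_ι_comp_eq_zero {X Y Z : E} (g : X ⟶ Y) [IsRegularEpi g]
    (h : X ⟶ Z) (w : kernel.ι g ≫ h = 0) : ∃ l, g ≫ l = h := by
  obtain ⟨N⟩ := nonempty_normalEpi_of_isRegularEpi g
  obtain ⟨l, hl⟩ := NormalEpi.desc' g h (by
    rw [← kernel.lift_ι g N.g N.w, Category.assoc, w, comp_zero])
  exact ⟨l, hl⟩

theorem exists_pushforward_kernel_ι [HasZeroObject E] [HasBinaryBiproducts E] [IsQuasiAbelian E]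
    {X Y Z : E} (g : X ⟶ Y) [IsRegularEpi g] (s : kernel g ⟶ Z) :
    ∃ (P : E) (a : Z ⟶ P) (b : X ⟶ P) (c : P ⟶ Y) (w : a ≫ c = 0),
      kernel.ι g ≫ b = s ≫ a ∧ b ≫ c = g ∧ Nonempty (IsLimit (KernelFork.ofι a w)) := by
  have : HasCoequalizers E := Preadditive.hasCoequalizers_of_hasCokernels
  have : HasPushouts E := hasPushouts_of_hasBinaryCoproducts_of_hasCoequalizers E
  have sq := IsPushout.of_hasPushout (kernel.ι g) s
  have := IsQuasiAbelian.isRegularMono_of_isPushout sq inferInstance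
  obtain ⟨N⟩ := nonempty_normalMono_of_isRegularMono (pushout.inr (kernel.ι g) s)
  obtain ⟨l, hl⟩ := exists_comp_eq_of_kernel_ι_comp_eq_zero g (pushout.inl _ s ≫ N.g) (by
    rw [sq.w_assoc, N.w, comp_zero])
  have hg : kernel.ι g ≫ g = s ≫ (0 : Z ⟶ Y) := by rw [kernel.condition, comp_zero]
  have hcl : sq.desc g 0 hg ≫ l = N.g := sq.hom_ext (by rw [sq.inl_desc_assoc, hl])
    (by rw [sq.inr_desc_assoc, zero_comp, N.w])
  exact ⟨_, _, _, sq.desc g 0 hg, sq.inr_desc _ _ _, sq.w, sq.inl_desc _ _ _,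
    ⟨isKernelOfComp l N.g N.isLimit (sq.inr_desc _ _ _) hcl⟩⟩

end Preadditive

variable {E : Type u} [Category.{v} E] [Preadditive E]
  {A : Type w} [Category.{w'} A] [Abelian A]

/-- A functor to an abelian category which sends regular epimorphisms to epimorphisms, and for
which every epimorphism `B ⟶ y X` from a subobject `B` of some `y Z` has a section after pulling
back along a regular epimorphism `X' ⟶ X`. The example is the Yoneda embedding in the category of
sheaves for the regular topology. -/
structure IsRegularEmbedding (y : E ⥤ A) : Prop where
  epi_map : ∀ {X Y : E} (g : X ⟶ Y), IsRegularEpi g → Epi (y.map g)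
  exists_lift : ∀ {B : A} {X Z : E} (p : B ⟶ y.obj X) (m : B ⟶ y.obj Z), Epi p → Mono m →
    ∃ (X' : E) (g : X' ⟶ X) (a : y.obj X' ⟶ B), IsRegularEpi g ∧ a ≫ p = y.map g

/-- The objects `B` with an epimorphism `y X ⟶ B` whose kernel is in the image of `y`. For the
Yoneda embedding `y` in sheaves, they form the abelian category in which `E` is the torsion-free
class of a cotilting torsion pair. -/
def quotients (y : E ⥤ A) : ObjectProperty A := fun B =>
  ∃ (X : E) (p : y.obj X ⟶ B), Epi p ∧ y.essImage (kernel p)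

section

variable (y : E ⥤ A)

instance : (quotients y).IsClosedUnderIsomorphisms where
  of_iso := by
    rintro B B' e ⟨X, p, hp, h⟩
    exact ⟨X, p ≫ e.hom, inferInstance, y.essImage.prop_of_iso (kernelCompMono p e.hom).symm h⟩

variable [y.Additive]

theorem quotients_biprod [HasBinaryBiproducts E] {B B' : A} (hB : quotients y B)
    (hB' : quotients y B') : quotients y (B ⊞ B') := by
  have := preservesBinaryBiproducts_of_preservesBiproducts y
  obtain ⟨X, p, _, hp⟩ := hB
  obtain ⟨X', p', _, hp'⟩ := hB'
  refine ⟨X ⊞ X', (y.mapBiprod X X').hom ≫ biprod.map p p', inferInstance, ?_⟩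
  let k : kernel p ⊞ kernel p' ⟶ y.obj X ⊞ y.obj X' := biprod.map (kernel.ι p) (kernel.ι p')
  have w : k ≫ biprod.map p p' = 0 := by
    apply biprod.hom_ext' <;> simp [k]
  have hk : IsLimit (KernelFork.ofι k w) := KernelFork.IsLimit.ofι' _ _ fun {W} t ht =>
    ⟨biprod.lift (kernel.lift p (t ≫ biprod.fst) (by simpa using ht =≫ biprod.fst))
      (kernel.lift p' (t ≫ biprod.snd) (by simpa using ht =≫ biprod.snd)),
      by apply biprod.hom_ext <;> simp [k]⟩
  exact y.essImage.prop_of_iso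
    (hk.conePointUniqueUpToIso (kernelIsKernel (biprod.map p p')) ≪≫
      (kernelIsIsoComp (y.mapBiprod X X').hom (biprod.map p p')).symm)
    (essImage_biprod y hp hp')

variable [y.Full] [PreservesFiniteLimits y] [HasKernels E]

variable {y} in
theorem essImage_kernel {B B' : A} (hB : y.essImage B) (hB' : y.essImage B') (f : B ⟶ B') :
    y.essImage (kernel f) := by
  obtain ⟨X, ⟨e⟩⟩ := hB
  obtain ⟨X', ⟨e'⟩⟩ := hB'
  obtain ⟨g, hg⟩ := y.map_surjective (e.hom ≫ f ≫ e'.inv)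
  exact ⟨kernel g, ⟨PreservesKernel.iso y g ≪≫ kernel.mapIso _ _ e e' (by simp [hg])⟩⟩

theorem containsZero_quotients [HasZeroObject E] : (quotients y).ContainsZero where
  exists_zero := by
    obtain ⟨Z, hZ⟩ := HasZeroObject.zero (C := E)
    exact ⟨y.obj Z, y.map_isZero hZ, Z, 𝟙 _, inferInstance,
      essImage_kernel (y.obj_mem_essImage _) (y.obj_mem_essImage _) _⟩

theorem isClosedUnderFiniteProducts_quotients [HasZeroObject E] [HasBinaryBiproducts E] :
    (quotients y).IsClosedUnderFiniteProducts := by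
  have := containsZero_quotients y
  have : (quotients y).IsClosedUnderBinaryProducts := ⟨by
    rintro B ⟨p, hp⟩
    let e : B ≅ p.diag.obj ⟨.left⟩ ⊞ p.diag.obj ⟨.right⟩ := p.isLimit.conePointsIsoOfNatIso
      (BinaryBiproduct.isLimit _ _) (diagramIsoPair p.diag)
    exact (quotients y).prop_of_iso e.symm (quotients_biprod y (hp _) (hp _))⟩
  exact ObjectProperty.IsClosedUnderFiniteProducts.mk'

end

theorem shortExact_map (y : E ⥤ A) [y.PreservesZeroMorphisms] [PreservesFiniteLimits y]
    {S : ShortComplex E} (hS : IsLimit (KernelFork.ofι S.f S.zero)) (hg : Epi (y.map S.g)) :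
    (S.map y).ShortExact where
  exact := ShortComplex.exact_of_f_is_kernel _ (isLimitForkMapOfIsLimit' y S.zero hS)
  mono_f := have : Mono S.f := mono_of_isLimit_fork hS; inferInstanceAs (Mono (y.map S.f))
  epi_g := hg

namespace IsRegularEmbedding

variable {y : E ⥤ A} [y.Full] [y.Additive] [PreservesFiniteLimits y] (hy : IsRegularEmbedding y)

include hy

theorem essImage_of_mono_of_epi [HasKernels E] [HasCokernels E] {B : A} {X₀ X : E}
    (p : y.obj X₀ ⟶ B) [Epi p] (m : B ⟶ y.obj X) [Mono m] : y.essImage B := by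
  obtain ⟨g, hg⟩ := y.map_surjective (p ≫ m)
  have := hy.epi_map (Abelian.coimage.π g) inferInstance
  have hk := isLimitForkMapOfIsLimit' y (kernel.condition g) (kernelIsKernel g)
  have hp : y.map (kernel.ι g) ≫ p = 0 := by
    rw [← cancel_mono m, Category.assoc, ← hg, ← y.map_comp, kernel.condition, y.map_zero,
      zero_comp]
  have hπ : y.map (kernel.ι g) ≫ y.map (Abelian.coimage.π g) = 0 := by
    rw [← y.map_comp, comp_coimage_π_eq_zero g _ (kernel.condition g), y.map_zero]
  have fac : y.map (Abelian.coimage.π g) ≫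
      y.map (Abelian.coimageImageComparison g ≫ Abelian.image.ι g) = y.map g := by
    rw [← y.map_comp, Abelian.coimage_image_factorisation]
  have hcπ := Abelian.epiIsCokernelOfKernel _ (isKernelOfComp _ _ hk hπ fac)
  have hcp := Abelian.epiIsCokernelOfKernel _ (isKernelOfComp _ _ hk hp hg.symm)
  exact ⟨_, ⟨hcπ.coconePointUniqueUpToIso hcp⟩⟩

variable [HasZeroObject E] [HasBinaryBiproducts E] [IsQuasiAbelian E]

-- Both `Q` and the pushout in `E` become, in `A`, the pushout of `y (ker g) ⟶ y X'` along
-- `y (ker g) ⟶ ker q`, where `g : X' ⟶ X` is a regular epimorphism which lifts to `Q`.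
theorem essImage_of_extension {Q : A} {X Z : E} (q : Q ⟶ y.obj X) [Epi q] (m : Q ⟶ y.obj Z)
    [Mono m] (hq : y.essImage (kernel q)) : y.essImage Q := by
  obtain ⟨X₁, ⟨e⟩⟩ := hq
  obtain ⟨X', g, α, hg, hα⟩ := hy.exists_lift q m inferInstance inferInstance
  let S := ShortComplex.mk (kernel.ι g) g (kernel.condition g)
  have hS : (S.map y).ShortExact := shortExact_map y (kernelIsKernel g) (hy.epi_map g hg)
  let SQ := ShortComplex.mk (e.hom ≫ kernel.ι q) q (by simp)
  have hSQ : SQ.ShortExact :=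
    { exact := ShortComplex.exact_of_f_is_kernel _
        (IsLimit.ofIsoLimit (kernelIsKernel q) (Fork.ext e.symm))
      mono_f := inferInstanceAs (Mono (e.hom ≫ kernel.ι q))
      epi_g := ‹Epi q› }
  have hw : (y.map (kernel.ι g) ≫ α) ≫ q = 0 := by
    rw [Category.assoc, hα, ← y.map_comp, kernel.condition, y.map_zero]
  obtain ⟨s, hs⟩ := y.map_surjective (kernel.lift q _ hw ≫ e.inv)
  let φ : S.map y ⟶ SQ :=
    { τ₁ := y.map s
      τ₂ := α
      τ₃ := 𝟙 _
      comm₁₂ := by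
        change y.map s ≫ e.hom ≫ kernel.ι q = y.map (kernel.ι g) ≫ α
        rw [hs, Category.assoc, e.inv_hom_id_assoc, kernel.lift_ι]
      comm₂₃ := hα.trans (Category.comp_id _).symm }
  obtain ⟨P, a, b, c, w, hb, hc, ⟨hk⟩⟩ := exists_pushforward_kernel_ι g s
  let SP := ShortComplex.mk a c w
  have hSP : (SP.map y).ShortExact := shortExact_map y hk
    (have := hy.epi_map g hg; epi_of_epi_fac (f := y.map b) (by rw [← y.map_comp, hc]))
  let ψ : S.map y ⟶ SP.map y := y.mapShortComplex.map { τ₁ := s, τ₂ := b, τ₃ := 𝟙 X }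
  have : IsIso φ.τ₃ := inferInstanceAs (IsIso (𝟙 _))
  have : IsIso ψ.τ₃ := inferInstanceAs (IsIso (y.map (𝟙 X)))
  exact ⟨P, ⟨(isPushout_of_shortExact hS hSP ψ).isoIsPushout _ _
    (isPushout_of_shortExact hS hSQ φ)⟩⟩

theorem essImage_pullback {X₀ X : E} {B : A} (h : y.obj X ⟶ B) (p : y.obj X₀ ⟶ B) [Epi p]
    (hp : y.essImage (kernel p)) : y.essImage (pullback h p) := by
  have sq := IsPullback.of_hasPullback h p
  have := isIso_kernel_map_of_isPullback sq
  have := preservesBinaryBiproducts_of_preservesBiproducts y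
  have : Mono (biprod.lift (pullback.fst h p) (pullback.snd h p)) := ⟨fun f g hfg =>
    pullback.hom_ext (by simpa using hfg =≫ biprod.fst) (by simpa using hfg =≫ biprod.snd)⟩
  exact hy.essImage_of_extension (pullback.fst h p)
    (biprod.lift (pullback.fst h p) (pullback.snd h p) ≫ (y.mapBiprod X X₀).inv)
    (y.essImage.prop_of_iso (asIso (kernel.map (pullback.fst h p) p _ _ sq.w)).symm hp)

theorem essImage_kernel_of_quotients {X : E} {B : A} (hB : quotients y B) (h : y.obj X ⟶ B) :
    y.essImage (kernel h) := by
  obtain ⟨X₀, p, _, hp⟩ := hB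
  have sq := (IsPullback.of_hasPullback h p).flip
  have := isIso_kernel_map_of_isPullback sq
  exact y.essImage.prop_of_iso (asIso (kernel.map (pullback.snd h p) h _ _ sq.w))
    (essImage_kernel (hy.essImage_pullback h p hp) (y.obj_mem_essImage X₀) _)

theorem isClosedUnderKernels : (quotients y).IsClosedUnderKernels where
  kernels_le := by
    rintro _ ⟨f, k, hk, hB, hD⟩
    have : Mono k.ι := mono_of_isLimit_fork hk
    obtain ⟨X, p, _, -⟩ := id hB
    obtain ⟨Z, ⟨e⟩⟩ := hy.essImage_kernel_of_quotients hD (p ≫ f)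
    obtain ⟨q, hq⟩ := KernelFork.IsLimit.lift' hk (e.hom ≫ kernel.ι (p ≫ f) ≫ p) (by simp)
    refine ⟨Z, q, ?_, y.essImage.prop_of_iso (kernelCompMono q k.ι)
      (hy.essImage_kernel_of_quotients hB (q ≫ k.ι))⟩
    rw [epi_iff_surjective_up_to_refinements]
    intro W t
    obtain ⟨W', π, _, x, hx⟩ := surjective_up_to_refinements_of_epi p (t ≫ k.ι)
    refine ⟨W', π, inferInstance, kernel.lift (p ≫ f) x (by
      rw [← reassoc_of% hx, k.condition, comp_zero, comp_zero]) ≫ e.inv, ?_⟩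
    rw [← cancel_mono k.ι, Category.assoc, Category.assoc, hq, Category.assoc,
      e.inv_hom_id_assoc, kernel.lift_ι_assoc, hx]

theorem isClosedUnderCokernels : (quotients y).IsClosedUnderCokernels where
  cokernels_le := by
    rintro _ ⟨f, c, hc, ⟨X, p, _, -⟩, ⟨Y, q, _, hq⟩⟩
    have : Epi c.π := epi_of_isColimit_cofork hc
    refine ⟨Y, q ≫ c.π, inferInstance, ?_⟩
    obtain ⟨Z, ⟨e⟩⟩ := hy.essImage_pullback (p ≫ f) q hq
    have hex : (ShortComplex.mk f c.π c.condition).Exact :=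
      ShortComplex.exact_of_g_is_cokernel _ (IsColimit.ofIsoColimit hc (Cofork.ext (Iso.refl _)))
    let r : y.obj Z ⟶ kernel (q ≫ c.π) := kernel.lift _ (e.hom ≫ pullback.snd (p ≫ f) q) (by
      rw [Category.assoc, ← pullback.condition_assoc, Category.assoc, c.condition, comp_zero,
        comp_zero, comp_zero])
    have : Epi r := by
      rw [epi_iff_surjective_up_to_refinements]
      intro W t
      obtain ⟨W₁, π₁, _, x₁, hx₁⟩ := hex.exact_up_to_refinements (t ≫ kernel.ι _ ≫ q) (by simp)
      obtain ⟨W₂, π₂, _, x₂, hx₂⟩ := surjective_up_to_refinements_of_epi p x₁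
      dsimp only at hx₁
      refine ⟨W₂, π₂ ≫ π₁, inferInstance, pullback.lift x₂ (π₂ ≫ π₁ ≫ t ≫ kernel.ι _)
        (by simp only [Category.assoc, hx₁, reassoc_of% hx₂]) ≫ e.inv, ?_⟩
      rw [← cancel_mono (kernel.ι (q ≫ c.π))]
      simpa [r] using (pullback.lift_snd _ _ _).symm
    exact hy.essImage_of_mono_of_epi r (kernel.ι (q ≫ c.π))

end IsRegularEmbedding

end Quotients

/-! ### From resolutions to torsion pairs -/

section TorsionPairOfResolutions

variable {C : Type w} [Category.{w'} C] [Abelian C]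

theorem epi_of_isLimit_kernelFork {K A B D T : C} {k : K ⟶ A} {p : A ⟶ B} [Epi p] {r : B ⟶ D}
    {g : A ⟶ D} {w : k ≫ g = 0} (hk : IsLimit (KernelFork.ofι k w)) (hg : p ≫ r = g)
    {i : T ⟶ B} [Mono i] (hi : i ≫ r = 0) {s : K ⟶ T} (hs : s ≫ i = k ≫ p) : Epi s := by
  rw [epi_iff_surjective_up_to_refinements]
  intro W t
  obtain ⟨W', π, _, x, hx⟩ := surjective_up_to_refinements_of_epi p (t ≫ i)
  obtain ⟨x', hx'⟩ := KernelFork.IsLimit.lift' hk x (by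
    rw [← hg, ← reassoc_of% hx, hi, comp_zero, comp_zero])
  replace hx' : x' ≫ k = x := hx'
  refine ⟨W', π, inferInstance, x', ?_⟩
  rw [← cancel_mono i, Category.assoc, Category.assoc, hs, reassoc_of% hx', hx]

variable {E : Type u} [Category.{v} E]

theorem exists_isColimit_of_quotients {j : E ⥤ C} [j.Full] {B : C} (hB : quotients j B) :
    ∃ (X₁ X₀ : E) (f : X₁ ⟶ X₀) (p : j.obj X₀ ⟶ B) (w : j.map f ≫ p = 0),
      Nonempty (IsColimit (CokernelCofork.ofπ p w)) := by
  obtain ⟨X₀, p, _, X₁, ⟨e⟩⟩ := hB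
  obtain ⟨f, hf⟩ := j.map_surjective (e.hom ≫ kernel.ι p)
  have w : j.map f ≫ p = 0 := by rw [hf, Category.assoc, kernel.condition, comp_zero]
  exact ⟨X₁, X₀, f, p, w, ⟨Abelian.epiIsCokernelOfKernel (KernelFork.ofι (j.map f) w)
    (IsLimit.ofIsoLimit (kernelIsKernel p) (Fork.ext e.symm (by simp [hf])))⟩⟩

theorem essentiallySmall_quotients (y : E ⥤ C) [y.Full] :
    ObjectProperty.EssentiallySmall.{max u v} (quotients y) := by
  let ι := Σ (X₁ X₀ : E), (X₁ ⟶ X₀)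
  refine ⟨ObjectProperty.ofObj fun i : ι => cokernel (y.map i.2.2), inferInstance, fun B hB => ?_⟩
  obtain ⟨X₁, X₀, f, p, w, ⟨hp⟩⟩ := exists_isColimit_of_quotients hB
  exact ⟨_, ⟨(⟨X₁, X₀, f⟩ : ι)⟩,
    ⟨IsColimit.coconePointUniqueUpToIso hp (colimit.isColimit _)⟩⟩

theorem quotients_of_iso {A : Type*} [Category* A] [Abelian A] {y : E ⥤ A} {j : E ⥤ C}
    (F : C ⥤ A) [F.Full] [F.Faithful] [F.Additive]
    [∀ {X Y : C} (f : X ⟶ Y), PreservesLimit (parallelPair f 0) F]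
    (i : j ⋙ F ≅ y) {B : C} (hB : quotients y (F.obj B)) : quotients j B := by
  obtain ⟨X, p, _, Z, ⟨e⟩⟩ := hB
  obtain ⟨q, hq⟩ := F.map_surjective (i.hom.app X ≫ p)
  have : Epi (F.map q) := by rw [hq]; infer_instance
  exact ⟨X, q, F.epi_of_epi_map this, Z, ⟨F.preimageIso (i.app Z ≪≫ e ≪≫
    (kernelIsIsoComp (i.hom.app X) p).symm ≪≫ kernelIsoOfEq hq.symm ≪≫
      (PreservesKernel.iso F q).symm)⟩⟩

variable [Preadditive E] [HasZeroObject E] [HasBinaryBiproducts E] [IsQuasiAbelian E]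

theorem epi_factorThruImage {X Y : E} (f : X ⟶ Y) : Epi (Abelian.factorThruImage f) := by
  have : HasCoequalizers E := Preadditive.hasCoequalizers_of_hasCokernels
  have : HasPushouts E := hasPushouts_of_hasBinaryCoproducts_of_hasCoequalizers E
  refine Preadditive.epi_of_cancel_zero _ fun {Z} ψ hψ => ?_
  -- The pushout of the image inclusion along `ψ` is a monomorphism, and it kills `ψ`.
  have sq := IsPushout.of_hasPushout (Abelian.image.ι f) ψ
  have := IsQuasiAbelian.isRegularMono_of_isPushout sq inferInstance
  have : Mono (pushout.inr (Abelian.image.ι f) ψ) := (IsRegularMono.getStruct _).mono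
  have hf : f ≫ pushout.inl (Abelian.image.ι f) ψ = 0 := by
    rw [← zero_comp, ← hψ, Category.assoc, ← sq.w, reassoc_of% Abelian.image.fac f]
  rw [← cancel_mono (pushout.inr (Abelian.image.ι f) ψ), ← sq.w, ← cokernel.π_desc f _ hf,
    kernel.condition_assoc, zero_comp, zero_comp]

variable (j : E ⥤ C) [j.Full] [j.Faithful] [j.Additive] [PreservesFiniteLimits j]
  (hj : ∀ {X Y : E} (g : X ⟶ Y), IsRegularEpi g → Epi (j.map g))

include hj

theorem exists_shortExact_of_quotients {B : C} (hB : quotients j B) :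
    ∃ (T : C) (Y : E) (i : T ⟶ B) (r : B ⟶ j.obj Y) (w : i ≫ r = 0),
      (∀ (Z : E) (φ : T ⟶ j.obj Z), φ = 0) ∧ (ShortComplex.mk i r w).ShortExact := by
  obtain ⟨X₁, X₀, f, p, hfp, ⟨hp⟩⟩ := exists_isColimit_of_quotients hB
  have : Epi p := epi_of_isColimit_cofork hp
  obtain ⟨r, hr⟩ := CokernelCofork.IsColimit.desc' hp (j.map (cokernel.π f)) (by
    rw [← j.map_comp, cokernel.condition, j.map_zero])
  replace hr : p ≫ r = j.map (cokernel.π f) := hr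
  have := hj (cokernel.π f) inferInstance
  have : Epi r := epi_of_epi_fac hr
  refine ⟨kernel r, cokernel f, kernel.ι r, r, kernel.condition r, fun Z φ => ?_,
    ⟨ShortComplex.exact_kernel r⟩⟩
  let s : j.obj (Abelian.image f) ⟶ kernel r := kernel.lift r (j.map (Abelian.image.ι f) ≫ p) (by
    rw [Category.assoc, hr, ← j.map_comp, kernel.condition, j.map_zero])
  have hs : s ≫ kernel.ι r = j.map (Abelian.image.ι f) ≫ p := kernel.lift_ι _ _ _
  have : Epi s := epi_of_isLimit_kernelFork (isLimitForkMapOfIsLimit' j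
    (kernel.condition (cokernel.π f)) (kernelIsKernel _)) hr (kernel.condition r) hs
  have hfs : j.map (Abelian.factorThruImage f) ≫ s = 0 := by
    rw [← cancel_mono (kernel.ι r), Category.assoc, hs, ← j.map_comp_assoc, Abelian.image.fac,
      hfp, zero_comp]
  obtain ⟨ψ, hψ⟩ := j.map_surjective (s ≫ φ)
  have := epi_factorThruImage f
  have hψ₀ : ψ = 0 := by
    rw [← cancel_epi (Abelian.factorThruImage f), comp_zero]
    exact j.map_injective (by rw [j.map_comp, hψ, reassoc_of% hfs, zero_comp, j.map_zero])
  rw [← cancel_epi s, ← hψ, hψ₀, j.map_zero, comp_zero]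

theorem exists_cotilting_of_resolutions (hj' : ∀ B : C, quotients j B) :
    ∃ t : TorsionPair C, t.IsCotilting ∧ Nonempty (E ≌ t.free.FullSubcategory) := by
  refine ⟨{ torsion := fun T => ∀ (Z : E) (φ : T ⟶ j.obj Z), φ = 0
            free := j.essImage
            torsion_isClosedUnderIsomorphisms := ⟨fun e h Z φ => by
              rw [← cancel_epi e.hom, comp_zero, h Z (e.hom ≫ φ)]⟩
            hom_eq_zero := ?_
            exists_shortExact := fun B => ?_ }, fun B => ?_, ⟨j.toEssImage.asEquivalence⟩⟩
  · rintro T F hT ⟨Z, ⟨e⟩⟩ f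
    rw [← cancel_mono e.inv, zero_comp, hT Z (f ≫ e.inv)]
  · obtain ⟨T, Y, i, r, w, hT, h⟩ := exists_shortExact_of_quotients j hj (hj' B)
    exact ⟨T, j.obj Y, i, r, w, hT, j.obj_mem_essImage Y, h⟩
  · obtain ⟨X, p, _, -⟩ := hj' B
    exact ⟨_, p, j.obj_mem_essImage X, inferInstance⟩

omit hj

namespace IsRegularEmbedding

variable {A : Type*} [Category* A] [Abelian A] {y : E ⥤ A} [y.Full] [y.Faithful] [y.Additive]
  [PreservesFiniteLimits y] (hy : IsRegularEmbedding y)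

include hy

theorem exists_cotilting_of_iso {j : E ⥤ C} (F : C ⥤ A) [F.Full] [F.Faithful] [F.Additive]
    [∀ {X Y : C} (f : X ⟶ Y), PreservesLimit (parallelPair f 0) F] (i : j ⋙ F ≅ y)
    (hF : ∀ B : C, quotients y (F.obj B)) :
    ∃ t : TorsionPair C, t.IsCotilting ∧ Nonempty (E ≌ t.free.FullSubcategory) := by
  have : (j ⋙ F).Full := Functor.Full.of_iso i.symm
  have : j.Full := Functor.Full.of_comp_faithful j F
  have : j.Faithful := Functor.Faithful.of_comp_iso i
  have : (j ⋙ F).Additive := Functor.additive_of_iso i.symm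
  have : j.Additive := Functor.additive_of_comp_faithful j F
  have : PreservesFiniteLimits (j ⋙ F) := preservesFiniteLimits_of_natIso i.symm
  have : PreservesFiniteLimits j := preservesFiniteLimits_of_reflects_of_preserves j F
  refine exists_cotilting_of_resolutions j (fun {X Y} g hg => F.epi_of_epi_map ?_)
    (fun B => quotients_of_iso F i (hF B))
  have := hy.epi_map g hg
  change Epi ((j ⋙ F).map g)
  rw [← NatIso.naturality_2 i g]
  infer_instance

theorem exists_cotilting [LocallySmall.{max u v} A] :
    ∃ (S : Type (max u v)) (_ : Category.{max u v} S) (_ : Abelian S) (t : TorsionPair S),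
      t.IsCotilting ∧ Nonempty (E ≌ t.free.FullSubcategory) := by
  let P := quotients y
  have := hy.isClosedUnderKernels
  have := hy.isClosedUnderCokernels
  have := containsZero_quotients y
  have := isClosedUnderFiniteProducts_quotients y
  have := essentiallySmall_quotients y
  let S := SmallModel.{max u v} P.FullSubcategory
  let ε : P.FullSubcategory ≌ S := equivSmallModel _
  let _ : Preadditive S := .ofFullyFaithful ε.fullyFaithfulInverse
  have : ε.inverse.Additive := ε.fullyFaithfulInverse.additive_ofFullyFaithful
  have : HasFiniteProducts S := ⟨fun n => Adjunction.hasLimitsOfShape_of_equivalence ε.inverse⟩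
  let _ : Abelian S := abelianOfEquivalence ε.inverse
  have (X : E) : P (y.obj X) := ⟨X, 𝟙 _, inferInstance,
    essImage_kernel (y.obj_mem_essImage _) (y.obj_mem_essImage _) _⟩
  let i : (P.lift y this ⋙ ε.functor) ⋙ ε.inverse ⋙ P.ι ≅ y := Functor.isoWhiskerRight
    (Functor.associator _ _ _ ≪≫ Functor.isoWhiskerLeft _ ε.unitIso.symm) P.ι
  have {X Y : S} (f : X ⟶ Y) : PreservesLimit (parallelPair f 0) (ε.inverse ⋙ P.ι) := by
    have := P.preservesKernels_ι (ε.inverse.map f)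
    have : PreservesLimit (parallelPair f 0 ⋙ ε.inverse) P.ι :=
      preservesLimit_of_iso_diagram P.ι (K₁ := parallelPair (ε.inverse.map f) 0)
        (parallelPair.ext (Iso.refl _) (Iso.refl _) (by simp) (by simp))
    infer_instance
  exact ⟨S, inferInstance, inferInstance,
    hy.exists_cotilting_of_iso (ε.inverse ⋙ P.ι) i fun B => (ε.inverse.obj B).property⟩

end IsRegularEmbedding

end TorsionPairOfResolutions

/-! ### The Yoneda embedding in sheaves for the regular topology -/

section Sheaves

open Opposite

section

variable {C : Type u} [Category.{v} C] [Preadditive C]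

theorem additive_of_mono {D : Type w} [Category.{w'} D] [Preadditive D] {F G : C ⥤ D}
    (τ : F ⟶ G) [∀ X, Mono (τ.app X)] [G.Additive] : F.Additive where
  map_add {X Y f g} := by
    rw [← cancel_mono (τ.app Y), Preadditive.add_comp, τ.naturality, τ.naturality, τ.naturality,
      G.map_add, Preadditive.comp_add]

instance : (preadditiveYoneda : C ⥤ _).Additive where
  map_add {X Y f g} := by
    ext Z h
    exact Preadditive.comp_add _ _ _ _ _ _

instance : PreservesFiniteLimits (preadditiveYoneda : C ⥤ Cᵒᵖ ⥤ AddCommGrpCat.{v}) where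
  preservesFiniteLimits J _ _ := preservesLimitsOfShape_of_evaluation _ _ fun X =>
    inferInstanceAs (PreservesLimitsOfShape J (preadditiveCoyoneda.obj X))

/-- The morphism from a representable functor which corresponds to an element of an additive
functor by the Yoneda lemma. -/
def preadditiveYonedaDesc (F : Cᵒᵖ ⥤ AddCommGrpCat.{v}) [F.Additive] {X : C} (b : F.obj (op X)) :
    preadditiveYoneda.obj X ⟶ F where
  app U := AddCommGrpCat.ofHom (AddMonoidHom.mk' (fun φ : unop U ⟶ X => F.map φ.op b)
    fun φ ψ : unop U ⟶ X => ConcreteCategory.congr_hom (F.map_add (f := φ.op) (g := ψ.op)) b)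
  naturality U V f := by
    ext φ
    exact ConcreteCategory.congr_hom (F.map_comp (Quiver.Hom.op (V := C) φ) f) b

end

theorem IsQuasiAbelian.regular (E : Type u) [Category.{v} E] [Preadditive E] [HasZeroObject E]
    [HasBinaryBiproducts E] [IsQuasiAbelian E] : Regular E := by
  have : HasEqualizers E := Preadditive.hasEqualizers_of_hasKernels
  have := hasFiniteProducts_of_has_binary_and_terminal (C := E)
  have : HasCoequalizers E := Preadditive.hasCoequalizers_of_hasCokernels
  exact
    { toHasFiniteLimits := hasFiniteLimits_of_hasEqualizers_and_finite_products
      hasCoequalizer_of_isKernelPair := fun _ => inferInstance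
      regularEpiIsStableUnderBaseChange :=
        ⟨fun sq hg => IsQuasiAbelian.isRegularEpi_of_isPullback sq.flip hg⟩ }

variable (E : Type w) [SmallCategory E] [Preadditive E] [Regular E]

theorem isSheaf_preadditiveYoneda (X : E) :
    Presheaf.IsSheaf (regularTopology E) (preadditiveYoneda.obj X) := by
  rw [Presheaf.isSheaf_iff_isSheaf_forget _ _ (forget AddCommGrpCat.{w}),
    isSheaf_iff_isSheaf_of_type]
  exact regularTopology.isSheaf_yoneda_obj X

/-- The Yoneda embedding in the category of abelian sheaves for the regular topology. -/
def sheafYoneda : E ⥤ Sheaf (regularTopology E) AddCommGrpCat.{w} :=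
  ObjectProperty.lift _ preadditiveYoneda (isSheaf_preadditiveYoneda E)

instance : (sheafYoneda E).Full := inferInstanceAs (ObjectProperty.lift _ _ _).Full

instance : (sheafYoneda E).Faithful := inferInstanceAs (ObjectProperty.lift _ _ _).Faithful

instance : (sheafYoneda E).Additive where
  map_add := ObjectProperty.hom_ext _ preadditiveYoneda.map_add

instance : PreservesFiniteLimits (sheafYoneda E) := by
  have : PreservesFiniteLimits (sheafYoneda E ⋙ sheafToPresheaf _ _) :=
    inferInstanceAs (PreservesFiniteLimits preadditiveYoneda)
  exact preservesFiniteLimits_of_reflects_of_preserves _ (sheafToPresheaf _ _)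

variable {E}

theorem epi_sheafYoneda_map {X Y : E} (g : X ⟶ Y) [IsRegularEpi g] :
    Epi ((sheafYoneda E).map g) := by
  rw [← Sheaf.isLocallySurjective_iff_epi']
  refine ⟨fun {U} s => ?_⟩
  let s' : U ⟶ Y := s
  exact regularTopology.mem_sieves_of_hasEffectiveEpi _ ⟨pullback s' g, pullback.fst s' g,
    (isRegularEpi_iff_effectiveEpi _).1 inferInstance, pullback.snd s' g, pullback.condition.symm⟩

theorem exists_effectiveEpi_hom_app_eq {B : Sheaf (regularTopology E) AddCommGrpCat.{w}} {X : E}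
    (p : B ⟶ (sheafYoneda E).obj X) [Epi p] :
    ∃ (X' : E) (g : X' ⟶ X) (b : B.obj.obj (op X')), EffectiveEpi g ∧ p.hom.app (op X') b = g := by
  have : Sheaf.IsLocallySurjective p := (Sheaf.isLocallySurjective_iff_epi' _ p).2 inferInstance
  have h := Presheaf.imageSieve_mem (regularTopology E) p.hom (U := op X) (𝟙 X : X ⟶ X)
  rw [regularTopology.mem_sieves_iff_hasEffectiveEpi] at h
  obtain ⟨X', g, hg, b, hb⟩ := h
  exact ⟨X', g, b, hg, hb.trans (Category.comp_id g)⟩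

variable (E) in
theorem isRegularEmbedding_sheafYoneda : IsRegularEmbedding (sheafYoneda E) where
  epi_map g _ := epi_sheafYoneda_map g
  exists_lift {B X Z} p m _ _ := by
    -- A subsheaf of a representable sheaf is an additive functor, so that its sections correspond
    -- to morphisms from representable sheaves.
    have : ∀ U, Mono (m.hom.app U) := (NatTrans.mono_iff_mono_app m.hom).1
      (inferInstanceAs (Mono ((sheafToPresheaf _ _).map m)))
    have : ((sheafYoneda E).obj Z).obj.Additive :=
      inferInstanceAs (preadditiveYoneda.obj Z).Additive
    have : B.obj.Additive := additive_of_mono m.hom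
    obtain ⟨X', g, b, hg, hb⟩ := exists_effectiveEpi_hom_app_eq p
    refine ⟨X', g, ObjectProperty.homMk (preadditiveYonedaDesc B.obj b),
      (isRegularEpi_iff_effectiveEpi g).2 hg, ObjectProperty.hom_ext _ ?_⟩
    ext U φ
    exact (NatTrans.naturality_apply p.hom φ.op b).trans
      (congrArg (((sheafYoneda E).obj X).obj.map φ.op) hb)

end Sheaves

theorem IsQuasiAbelian.exists_cotilting (E : Type u) [Category.{v} E] [Preadditive E]
    [HasZeroObject E] [HasBinaryBiproducts E] [IsQuasiAbelian E] :
    ∃ (C : Type (max u v)) (_ : Category.{max u v} C) (_ : Abelian C) (t : TorsionPair C),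
      t.IsCotilting ∧ Nonempty (E ≌ t.free.FullSubcategory) := by
  let ε : E ≌ AsSmall.{max u v} E := AsSmall.equiv
  have : ε.functor.Additive := inferInstanceAs AsSmall.up.Additive
  have : HasZeroObject (AsSmall.{max u v} E) := ε.functor.hasZeroObject_of_additive
  have : HasBinaryBiproducts (AsSmall.{max u v} E) :=
    have := hasFiniteProducts_of_has_binary_and_terminal (C := E)
    have := ε.functor.hasFiniteProducts_of_additive_of_essSurj
    .of_hasBinaryProducts
  have : IsQuasiAbelian (AsSmall.{max u v} E) := IsQuasiAbelian.of_equivalence ε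
  have := IsQuasiAbelian.regular (AsSmall.{max u v} E)
  obtain ⟨C, _, _, t, ht, ⟨e⟩⟩ :=
    (isRegularEmbedding_sheafYoneda (AsSmall.{max u v} E)).exists_cotilting
  exact ⟨C, inferInstance, inferInstance, t, ht, ⟨ε.trans e⟩⟩

/-! ### Torsion pairs -/

namespace TorsionPair

variable {C : Type w} [Category.{w'} C] [Abelian C] (t : TorsionPair C)

/-- The opposite torsion pair, which exchanges tilting and cotilting. -/
def op : TorsionPair Cᵒᵖ where
  torsion := t.free.op
  free := t.torsion.op
  torsion_isClosedUnderIsomorphisms :=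
    have := t.free_isClosedUnderIsomorphisms
    inferInstance
  free_isClosedUnderIsomorphisms :=
    have := t.torsion_isClosedUnderIsomorphisms
    inferInstance
  hom_eq_zero hT hF f := Quiver.Hom.unop_inj (t.hom_eq_zero hF hT f.unop)
  exists_shortExact X := by
    obtain ⟨T, F, i, p, zero, hT, hF, h⟩ := t.exists_shortExact X.unop
    exact ⟨.op F, .op T, p.op, i.op, by rw [← op_comp, zero, op_zero], hF, hT, h.op⟩

variable {t} in
theorem IsTilting.op (ht : t.IsTilting) : t.op.IsCotilting := fun X =>
  let ⟨T, i, hT, _⟩ := ht X.unop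
  ⟨.op T, i.op, hT, inferInstance⟩

variable {t} in
theorem IsCotilting.op (ht : t.IsCotilting) : t.op.IsTilting := fun X =>
  let ⟨F, p, hF, _⟩ := ht X.unop
  ⟨.op F, p.op, hF, inferInstance⟩

theorem free_of_hom_eq_zero {A : C} (h : ∀ {T : C}, t.torsion T → ∀ f : T ⟶ A, f = 0) :
    t.free A := by
  have := t.free_isClosedUnderIsomorphisms
  obtain ⟨T, F, i, p, zero, hT, hF, hs⟩ := t.exists_shortExact A
  have : Mono p := hs.exact.mono_g (h hT i)
  have : Epi p := hs.epi_g
  have : IsIso p := isIso_of_mono_of_epi p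
  exact t.free.prop_of_iso (asIso p).symm hF

variable {E : Type u} [Category.{v} E]

theorem isTorsionFreeEmbedding (i : E ⥤ C) (hi : i.essImage = t.free) :
    IsTorsionFreeEmbedding i where
  of_mono {A X} m _ := by
    rw [hi]
    refine t.free_of_hom_eq_zero (fun hT f => ?_)
    rw [← cancel_mono m, zero_comp]
    exact t.hom_eq_zero hT (hi ▸ i.obj_mem_essImage X) _
  of_shortExact {S} hS h₁ h₃ := by
    rw [hi] at h₁ h₃ ⊢
    refine t.free_of_hom_eq_zero (fun hT f => ?_)
    have := hS.mono_f
    rw [← hS.exact.lift_f f (t.hom_eq_zero hT h₃ _), t.hom_eq_zero hT h₁ (hS.exact.lift f _),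
      zero_comp]
  exists_reflection A := by
    obtain ⟨T, F, j, p, zero, hT, hF, hs⟩ := t.exists_shortExact A
    rw [← hi] at hF
    obtain ⟨X, ⟨e⟩⟩ := hF
    have := hs.epi_g
    refine ⟨X, p ≫ e.inv, inferInstance, fun {Z} φ => ?_⟩
    have h0 : j ≫ φ = 0 := t.hom_eq_zero hT (hi ▸ i.obj_mem_essImage Z) _
    exact ⟨e.hom ≫ hs.exact.desc φ h0, by simpa using hs.exact.g_desc φ h0⟩

theorem essImage_equivalence (e : E ≌ t.free.FullSubcategory) :
    (e.functor ⋙ t.free.ι).essImage = t.free := by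
  have := t.free_isClosedUnderIsomorphisms
  ext A
  constructor
  · rintro ⟨X, ⟨i⟩⟩
    exact t.free.prop_of_iso i (e.functor.obj X).property
  · intro hA
    exact ⟨e.inverse.obj ⟨A, hA⟩, ⟨t.free.ι.mapIso (e.counitIso.app ⟨A, hA⟩)⟩⟩

variable [Preadditive E] [HasBinaryBiproducts E]

theorem additive_equivalence (e : E ≌ t.free.FullSubcategory) :
    (e.functor ⋙ t.free.ι).Additive := by
  have := Functor.additive_of_preserves_binary_products e.functor
  infer_instance

variable [HasZeroObject E]

theorem isQuasiAbelian_of_free (e : E ≌ t.free.FullSubcategory) : IsQuasiAbelian E :=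
  have := t.additive_equivalence e
  (t.isTorsionFreeEmbedding _ (t.essImage_equivalence e)).isQuasiAbelian

theorem isQuasiAbelian_of_torsion (e : E ≌ t.torsion.FullSubcategory) : IsQuasiAbelian E :=
  (isQuasiAbelian_op_iff E).1
    (t.op.isQuasiAbelian_of_free (e.op.trans t.torsion.opEquivalence.symm))

variable {t} in
theorem IsCotilting.exists_leftHeart_equivalence (ht : t.IsCotilting)
    (e : E ≌ t.free.FullSubcategory) :
    ∃ (_ : IsQuasiAbelian E) (Φ : LeftHeart E ≌ C),
      Nonempty (toLeftHeart E ⋙ Φ.functor ≅ e.functor ⋙ t.free.ι) := by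
  have := t.additive_equivalence e
  have := t.isQuasiAbelian_of_free e
  refine ⟨this, (t.isTorsionFreeEmbedding _
    (t.essImage_equivalence e)).exists_leftHeart_equivalence (fun A => ?_)⟩
  obtain ⟨F, p, hF, _⟩ := ht A
  rw [← t.essImage_equivalence e] at hF
  obtain ⟨X, ⟨i⟩⟩ := hF
  exact ⟨X, i.hom ≫ p, inferInstance⟩

variable {t} in
theorem IsTilting.exists_rightHeart_equivalence (ht : t.IsTilting)
    (e : E ≌ t.torsion.FullSubcategory) :
    ∃ (_ : IsQuasiAbelian E) (Φ : RightHeart E ≌ C),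
      Nonempty (toRightHeart E ⋙ Φ.functor ≅ e.functor ⋙ t.torsion.ι) := by
  obtain ⟨_, Φ, ⟨i⟩⟩ := ht.op.exists_leftHeart_equivalence
    (e.op.trans t.torsion.opEquivalence.symm)
  exact ⟨t.isQuasiAbelian_of_torsion e, Φ.op.trans (opOpEquivalence C),
    ⟨NatIso.ofComponents (fun X => (i.app (.op X)).unop.symm)
      fun f => Quiver.Hom.op_inj (i.inv.naturality f.op).symm⟩⟩

end TorsionPair

theorem IsQuasiAbelian.exists_tilting (E : Type u) [Category.{v} E] [Preadditive E]
    [HasZeroObject E] [HasBinaryBiproducts E] [IsQuasiAbelian E] :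
    ∃ (C : Type (max u v)) (_ : Category.{max u v} C) (_ : Abelian C) (t : TorsionPair C),
      t.IsTilting ∧ Nonempty (E ≌ t.torsion.FullSubcategory) := by
  have := IsQuasiAbelian.op E
  obtain ⟨C, _, _, t, ht, ⟨e⟩⟩ := IsQuasiAbelian.exists_cotilting Eᵒᵖ
  exact ⟨Cᵒᵖ, inferInstance, inferInstance, t.op, ht.op,
    ⟨(opOpEquivalence E).symm.trans (e.op.trans t.free.opEquivalence.symm)⟩⟩

end QuasiAbelian

end

/-- An additive category is quasi-abelian if and only if it is equivalent to the torsion-free part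
of a cotilting torsion pair, if and only if it is equivalent to the torsion part of a tilting
torsion pair. In these situations the ambient abelian category is equivalent to the left,
respectively right, heart, compatibly with the embeddings of the additive category.
(An equivalence between additive categories is automatically an additive functor.) -/
theorem mainTheorem12 (E : Type u) [Category.{v} E] [Preadditive E] [HasZeroObject E]
    [HasBinaryBiproducts E] :
    List.TFAE
      [IsQuasiAbelian E,
        ∃ (C : Type (max u v)) (_ : Category.{max u v} C) (_ : Abelian C) (t : TorsionPair C),
          t.IsCotilting ∧ Nonempty (E ≌ t.free.FullSubcategory),
        ∃ (C : Type (max u v)) (_ : Category.{max u v} C) (_ : Abelian C) (t : TorsionPair C),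
          t.IsTilting ∧ Nonempty (E ≌ t.torsion.FullSubcategory)] ∧
    (∀ (C : Type w) [Category.{w'} C] [Abelian C] (t : TorsionPair C), t.IsCotilting →
      ∀ e : E ≌ t.free.FullSubcategory, ∃ (_ : IsQuasiAbelian E) (Φ : LeftHeart E ≌ C),
        Nonempty (toLeftHeart E ⋙ Φ.functor ≅ e.functor ⋙ t.free.ι)) ∧
    (∀ (C : Type w) [Category.{w'} C] [Abelian C] (t : TorsionPair C), t.IsTilting →
      ∀ e : E ≌ t.torsion.FullSubcategory, ∃ (_ : IsQuasiAbelian E) (Φ : RightHeart E ≌ C),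
        Nonempty (toRightHeart E ⋙ Φ.functor ≅ e.functor ⋙ t.torsion.ι)) := by
  refine ⟨?_, fun C _ _ t ht e => ht.exists_leftHeart_equivalence e,
    fun C _ _ t ht e => ht.exists_rightHeart_equivalence e⟩
  tfae_have 1 → 2 := fun _ => IsQuasiAbelian.exists_cotilting E
  tfae_have 2 → 1 := fun ⟨_, _, _, t, _, ⟨e⟩⟩ => t.isQuasiAbelian_of_free e
  tfae_have 1 → 3 := fun _ => IsQuasiAbelian.exists_tilting E
  tfae_have 3 → 1 := fun ⟨_, _, _, t, _, ⟨e⟩⟩ => t.isQuasiAbelian_of_torsion e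
  tfae_finish
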